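/- Let $V$ be a valuation domain (a commutative integral domain whose ideals form a chain), and let $\mathcal C_V^*$ be the class whose objects are the $V$-modules of projective dimension $\le 1$ and whose morphisms are the $V$-homomorphisms between objects having kernel and cokernel of projective dimension $\le 1$. A submodule $A$ of an object $B$ is a subobject (is tight in $B$) if $B/A$ has projective dimension $\le 1$. A submodule $A$ of $B$ is pure if every finite system of linear equations with coefficients in $V$ and right-hand sides in $A$ which is solvable in $B$ is solvable in $A$; a pure subobject is a subobject that is pure. A system of equations $\sum_{j\in J_i} r_{ij}x_j=a_i$ $(i\in I)$ over a $V$-module $N$ (with $I,J$ arbitrary sets, $J_i\subseteq J$ finite, $r_{ij}\in V$, $a_i\in N$) is called adequate if, with $F$ the free $V$-module on the unknowns $x_j$ $(j\in J)$ and $H\le F$ the submodule generated by the left-hand sides, (1) it is consistent, i.e. $\sum_{j\in J_i} r_{ij}x_j\mapsto a_i$ $(i\in I)$ gives a well-defined homomorphism $H\to N$; (2) $F/H$ has projective dimension $\le 1$; (3) every finite subsystem is solvable in $N$. An object $N$ of $\mathcal C_V^*$ is pure-injective if it has the following properties (which are equivalent to one another for objects): - ($\alpha$) $\mathrm{Pext}^1_V(C,N)=0$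 for all objects $C$, i.e. every exact sequence $0\to N\to X\to C\to 0$ with $C$ an object and the image of $N$ pure in $X$ splits; - ($\beta$) if $A$ is a pure subobject of an object $B$, every $\mathcal C_V^*$-morphism $A\to N$ extends to a $V$-homomorphism $B\to N$ (not necessarily a $\mathcal C_V^*$-morphism); - ($\gamma$) every adequate equation system over $N$ has a global solution in $N$. Theorem. Every object $M$ of $\mathcal C_V^*$ is (isomorphic to) a pure subobject of a pure-injective object: there are a pure-injective object $N$ of $\mathcal C_V^*$ and an injective $V$-homomorphism $M\to N$ whose image is pure and tight in $N$. -/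

import Mathlib

universe u v w

namespace TightModules

section

variable (V : Type u) [CommRing V]

/-- The objects of the class `C_V^*`: the `V`-modules of projective dimension at most one. -/
def IsObject (M : Type w) [AddCommGroup M] [Module V M] : Prop :=
  CategoryTheory.HasProjectiveDimensionLE (ModuleCat.of V M) 1

end

section

variable {V : Type u} [CommRing V]

/-- A submodule `A` of an object `B` is tight (that is, a subobject of `B`) if `B ⧸ A` is again of
projective dimension at most one. -/
def IsTight {B : Type w} [AddCommGroup B] [Module V B] (A : Submodule V B) : Prop :=
  IsObject V (B ⧸ A)

/-- A submodule `A` of `B` is pure if every finite system of linear equations with right-hand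
sides in `A` that is solvable in `B` is solvable in `A`. -/
def IsPure {B : Type w} [AddCommGroup B] [Module V B] (A : Submodule V B) : Prop :=
  ∀ (m n : ℕ) (r : Fin m → Fin n → V) (a : Fin m → A),
    (∃ x : Fin n → B, ∀ i, ∑ j, r i j • x j = (a i : B)) →
      ∃ y : Fin n → A, ∀ i, ∑ j, r i j • y j = a i

/-- The morphisms of `C_V^*` between two objects: the module homomorphisms whose kernel and
cokernel are objects. -/
def IsMorphism {A M : Type w} [AddCommGroup A] [Module V A] [AddCommGroup M] [Module V M]
    (f : A →ₗ[V] M) : Prop :=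
  IsObject V (LinearMap.ker f) ∧ IsObject V (M ⧸ LinearMap.range f)

end

section

variable (V : Type u) [CommRing V]

/-- A system of linear equations `∑_j r_{ij} x_j = a_i` (`i ∈ I`) over the module `M` in the
unknowns `x_j` (`j ∈ J`). Each equation involves finitely many unknowns: its left side is the
element `∑_j r_{ij} x_j` of the free module on the unknowns. -/
structure LinearSystem (I J : Type w) (M : Type w) where
  /-- The left side of the `i`-th equation. -/
  lhs : I → (J →₀ V)
  /-- The right side of the `i`-th equation. -/
  rhs : I → M

end

namespace LinearSystem

variable {V : Type u} [CommRing V] {I J M : Type w} [AddCommGroup M] [Module V M]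

/-- The submodule of the free module on the unknowns that is generated by the left sides. -/
noncomputable def lhsSpan (S : LinearSystem V I J M) : Submodule V (J →₀ V) :=
  Submodule.span V (Set.range S.lhs)

/-- The assignment `x` of elements of `M` to the unknowns satisfies the `i`-th equation. -/
def SatisfiesAt (S : LinearSystem V I J M) (x : J → M) (i : I) : Prop :=
  ((S.lhs i).sum fun j r => r • x j) = S.rhs i

/-- The system has a (global) solution in `M`. -/
def Solvable (S : LinearSystem V I J M) : Prop :=
  ∃ x : J → M, ∀ i, S.SatisfiesAt x i

/-- Every finite subsystem has a solution in `M`. -/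
def FinitelySolvable (S : LinearSystem V I J M) : Prop :=
  ∀ s : Finset I, ∃ x : J → M, ∀ i ∈ s, S.SatisfiesAt x i

/-- The system is consistent: sending each left side to the corresponding right side gives a
well-defined homomorphism on the submodule generated by the left sides. -/
def Consistent (S : LinearSystem V I J M) : Prop :=
  ∃ φ : S.lhsSpan →ₗ[V] M,
    ∀ i, φ ⟨S.lhs i, Submodule.subset_span (Set.mem_range_self i)⟩ = S.rhs i

/-- An adequate system: consistent, finitely solvable, and of projective dimension at most one,
where the projective dimension of the system is that of the free module on the unknowns modulo
the submodule generated by the left sides. -/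
structure Adequate (S : LinearSystem V I J M) : Prop where
  consistent : S.Consistent
  projDim_le_one : IsObject V ((J →₀ V) ⧸ S.lhsSpan)
  finitelySolvable : S.FinitelySolvable

end LinearSystem

section

variable (V : Type u) [CommRing V] (M : Type w) [AddCommGroup M] [Module V M]

/-- `Pext¹(C, M) = 0` for all objects `C`: every pure-exact sequence `0 → M → N → C → 0` with an
object `C` splits. -/
def PextVanishes : Prop :=
  ∀ (C N : Type w) [AddCommGroup C] [Module V C] [AddCommGroup N] [Module V N]
    (f : M →ₗ[V] N) (g : N →ₗ[V] C), IsObject V C →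
    Function.Injective f → Function.Exact f g → Function.Surjective g →
    IsPure (LinearMap.range f) →
      ∃ s : N →ₗ[V] M, s ∘ₗ f = LinearMap.id

/-- Every morphism of `C_V^*` from a pure subobject `A` of an object `B` to `M` extends to a module
homomorphism `B → M`, which need not be a morphism of `C_V^*`. -/
def ExtendsFromPureSubobjects : Prop :=
  ∀ (B : Type w) [AddCommGroup B] [Module V B] (A : Submodule V B), IsObject V B →
    IsTight A → IsPure A →
    ∀ f : A →ₗ[V] M, IsMorphism f → ∃ g : B →ₗ[V] M, ∀ a : A, g a = f a

/-- Every adequate system of equations over `M` has a global solution in `M`. -/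
def SolvesAdequateSystems : Prop :=
  ∀ (I J : Type w) (S : LinearSystem V I J M), S.Adequate → S.Solvable

/-- The pure-injective objects of `C_V^*`: the objects with the three usual properties, each of
which characterizes them among the objects. -/
structure IsPureInjective : Prop where
  isObject : IsObject V M
  pextVanishes : PextVanishes V M
  extendsFromPureSubobjects : ExtendsFromPureSubobjects V M
  solvesAdequateSystems : SolvesAdequateSystems V M

end

end TightModules

-- Call a monomorphism pure-tight if its image is pure and tight. It suffices to embed M
-- pure-tightly in a module N to which homomorphisms extend from every pure tight submodule: N is
-- then an object, as an extension of the cokernel by M, and the three properties follow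
-- (`isPureInjective_of_exists_extension`).
--
-- N comes from the small object argument, run on a set of inclusions representing all pure tight
-- submodules of modules of cardinality at most κ = max(ℵ₀, |V|). The resulting M → N is pure-tight
-- because pure-tightness is detected by left lifting properties
-- (`llp_rlp_pureTightMonomorphisms_le`). Purity of A → B means that A^m/rA^n → B^m/rB^n is
-- injective for every matrix r, which maps to injective modules E can test. Tightness means that
-- Ext¹(B/A, -) vanishes on quotients of injectives, which is lifting against surjections with such
-- kernels.
--
-- It remains to pass from small modules to all. `ExtendsFromSmall.exists_extension` treats large B
-- with |B/A| ≤ κ by cutting B down to a small submodule that maps onto B/A. In general,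
-- projectivity of the relation module of B/A gives a section of its free cover. Subsets of B/A
-- compatible with this section have pure tight spans, are stable under unions of chains and can be
-- enlarged by at most κ elements at a time, so Zorn's lemma finishes the extension.

universe w'

namespace TightModules

open CategoryTheory

/-! ### Projective dimension at most one and extension of homomorphisms. -/

section ProjectiveDimension

variable {V : Type u} [CommRing V]

theorem IsObject.congr {M N : Type w} [AddCommGroup M] [Module V M] [AddCommGroup N] [Module V N]
    (e : M ≃ₗ[V] N) (h : IsObject V M) : IsObject V N :=
  @hasProjectiveDimensionLT_of_iso _ _ _ _ _ e.toModuleIso 2 h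

section

variable {A B C : Type w} [AddCommGroup A] [Module V A] [AddCommGroup B] [Module V B]
  [AddCommGroup C] [Module V C] (f : A →ₗ[V] B) (g : B →ₗ[V] C)

/-- The short complex attached to a short exact sequence of modules is short exact. -/
theorem exists_shortExact (hf : Function.Injective f) (hfg : Function.Exact f g)
    (hg : Function.Surjective g) :
    ∃ w, (ShortComplex.mk (ModuleCat.ofHom f) (ModuleCat.ofHom g) w).ShortExact :=
  ⟨ModuleCat.hom_ext (hfg.linearMap_comp_eq_zero),
    ModuleCat.shortComplex_shortExact _ hfg hf hg⟩

theorem IsObject.of_exact (hf : Function.Injective f) (hfg : Function.Exact f g)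
    (hg : Function.Surjective g) (hA : IsObject V A) (hC : IsObject V C) : IsObject V B :=
  (exists_shortExact f g hf hfg hg).choose_spec.hasProjectiveDimensionLT_X₂ 2 hA hC

theorem IsObject.left_of_exact (hf : Function.Injective f) (hfg : Function.Exact f g)
    (hg : Function.Surjective g) (hB : IsObject V B) (hC : IsObject V C) : IsObject V A :=
  (exists_shortExact f g hf hfg hg).choose_spec.hasProjectiveDimensionLT_X₁ 2 hB
    (@hasProjectiveDimensionLT_of_ge _ _ _ _ 2 3 (by norm_num) hC)

end

section

variable {F C : Type (max u v)} [AddCommGroup F] [Module V F] [AddCommGroup C] [Module V C]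
  (g : F →ₗ[V] C)

theorem projective_ker_of_isObject (hg : Function.Surjective g) [Module.Projective V F]
    (hC : IsObject V C) : Module.Projective V (LinearMap.ker g) := by
  rw [IsProjective.iff_projective, projective_iff_hasProjectiveDimensionLT_one]
  have hF : HasProjectiveDimensionLT (ModuleCat.of V F) 1 :=
    projective_iff_hasProjectiveDimensionLT_one.1 ((IsProjective.iff_projective F).1 inferInstance)
  exact (exists_shortExact (LinearMap.ker g).subtype g (Submodule.subtype_injective _)
    g.exact_subtype_ker_map hg).choose_spec.hasProjectiveDimensionLT_X₁ 1 hF hC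

theorem isObject_of_projective_ker {K : Type (max u v)} [AddCommGroup K] [Module V K]
    (f : K →ₗ[V] F) (hf : Function.Injective f) (hfg : Function.Exact f g)
    (hg : Function.Surjective g) [Module.Projective V F] [Module.Projective V K] :
    IsObject V C := by
  have hF : HasProjectiveDimensionLT (ModuleCat.of V F) 1 :=
    projective_iff_hasProjectiveDimensionLT_one.1 ((IsProjective.iff_projective F).1 inferInstance)
  have hK : HasProjectiveDimensionLT (ModuleCat.of V K) 1 :=
    projective_iff_hasProjectiveDimensionLT_one.1 ((IsProjective.iff_projective K).1 inferInstance)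
  exact (exists_shortExact f g hf hfg hg).choose_spec.hasProjectiveDimensionLT_X₃ 1 hK
    (@hasProjectiveDimensionLT_of_ge _ _ _ _ 1 2 (by norm_num) hF)

end

end ProjectiveDimension

section Descent

variable {R : Type*} [Ring R] {P B Y : Type*} [AddCommGroup P] [Module R P] [AddCommGroup B]
  [Module R B] [AddCommGroup Y] [Module R Y]

theorem exists_comp_eq_of_ker_le (p : P →ₗ[R] B) (hp : Function.Surjective p) (h : P →ₗ[R] Y)
    (hk : LinearMap.ker p ≤ LinearMap.ker h) : ∃ g : B →ₗ[R] Y, g ∘ₗ p = h := by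
  refine ⟨(LinearMap.ker p).liftQ h hk ∘ₗ (p.quotKerEquivOfSurjective hp).symm.toLinearMap, ?_⟩
  ext x
  have : (p.quotKerEquivOfSurjective hp).symm (p x) = Submodule.Quotient.mk x := by
    rw [LinearEquiv.symm_apply_eq]; rfl
  simp [this]

theorem exists_comp_eq_of_range_le (f : Y →ₗ[R] B) (hf : Function.Injective f) (h : P →ₗ[R] B)
    (hk : LinearMap.range h ≤ LinearMap.range f) : ∃ g : P →ₗ[R] Y, f ∘ₗ g = h := by
  refine ⟨(LinearEquiv.ofInjective f hf).symm.toLinearMap ∘ₗ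
    h.codRestrict (LinearMap.range f) (fun x => hk ⟨x, rfl⟩), ?_⟩
  ext x
  have := (LinearEquiv.ofInjective f hf).apply_symm_apply
    ⟨h x, hk ⟨x, rfl⟩⟩
  simp

end Descent

section Extension

variable {V : Type u} [CommRing V]

/-- Homomorphisms from a tight submodule to a quotient of an injective module extend. -/
theorem exists_extension_to_quotient_of_injective {A B Q Y : Type (max u v)} [AddCommGroup A]
    [Module V A] [AddCommGroup B] [Module V B] [AddCommGroup Q] [Module V Q] [AddCommGroup Y]
    [Module V Y] (j : A →ₗ[V] B) (hj : Function.Injective j)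
    (hB : IsObject V (B ⧸ LinearMap.range j)) (hQ : Module.Injective V Q) (q : Q →ₗ[V] Y)
    (hq : Function.Surjective q) (φ : A →ₗ[V] Y) : ∃ ψ : B →ₗ[V] Y, ψ ∘ₗ j = φ := by
  -- B is the pushout of A and this free module along `ker π`, which is projective. So `φ ∘ₗ α`
  -- lifts to Q, extends to the free module because Q is injective, and glues with `φ`.
  let π := Finsupp.linearCombination V (id : (B ⧸ LinearMap.range j) → _)
  have hπ : Function.Surjective π := Finsupp.linearCombination_id_surjective V _
  have := projective_ker_of_isObject.{u, v} π hπ hB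
  obtain ⟨β, hβ⟩ := Module.projective_lifting_property (LinearMap.range j).mkQ π
    (Submodule.mkQ_surjective _)
  have hβ' : ∀ x, (LinearMap.range j).mkQ (β x) = π x := fun x => congrArg (fun l => l x) hβ
  have hβ₀ : ∀ x, β x ∈ LinearMap.range j ↔ x ∈ LinearMap.ker π := fun x => by
    rw [LinearMap.mem_ker, ← hβ' x, Submodule.mkQ_apply, Submodule.Quotient.mk_eq_zero]
  obtain ⟨α, hα⟩ := exists_comp_eq_of_range_le (P := LinearMap.ker π) j hj
    (β ∘ₗ (LinearMap.ker π).subtype) (by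
    rintro _ ⟨x, rfl⟩
    exact (hβ₀ x).2 x.2)
  have hα' : ∀ x, j (α x) = β x := fun x => congrArg (fun l => l x) hα
  obtain ⟨χ, hχ⟩ := Module.projective_lifting_property q (φ ∘ₗ α) hq
  have hχ' : ∀ x, q (χ x) = φ (α x) := fun x => congrArg (fun l => l x) hχ
  obtain ⟨χ₁, hχ₁⟩ := hQ.out (X := LinearMap.ker π) (Y := (B ⧸ LinearMap.range j) →₀ V)
    (LinearMap.ker π).subtype (Submodule.subtype_injective _) χ
  obtain ⟨ψ, hψ⟩ := exists_comp_eq_of_ker_le (j.coprod β) (by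
      intro b
      obtain ⟨x, hx⟩ := hπ ((LinearMap.range j).mkQ b)
      rw [← hβ' x, Submodule.mkQ_apply, Submodule.mkQ_apply, Submodule.Quotient.eq] at hx
      obtain ⟨a, ha⟩ := hx
      exact ⟨(-a, x), by simp [ha]⟩)
    (φ.coprod (q ∘ₗ χ₁)) (by
      rintro ⟨a, x⟩ h
      have h : j a + β x = 0 := by simpa using h
      have hx : x ∈ LinearMap.ker π :=
        (hβ₀ x).1 ⟨-a, by rw [map_neg, neg_eq_iff_add_eq_zero, h]⟩
      have h1 : α ⟨x, hx⟩ = -a := hj (by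
        rw [hα', map_neg]
        exact (neg_eq_of_add_eq_zero_right h).symm)
      have h2 := hχ₁ ⟨x, hx⟩
      simp only [Submodule.subtype_apply] at h2
      simp [h2, hχ', h1])
  refine ⟨ψ, LinearMap.ext fun a => ?_⟩
  simpa using congrArg (fun l => l (a, 0)) hψ

end Extension

/-! ### Purity and pushouts of extensions. -/

section Purity

variable {V : Type u} [CommRing V]

theorem isPure_iff {B : Type w} [AddCommGroup B] [Module V B] {A : Submodule V B} :
    IsPure A ↔ ∀ (m n : ℕ) (r : Fin m → Fin n → V) (x : Fin n → B),
      (∀ i, ∑ j, r i j • x j ∈ A) →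
        ∃ y : Fin n → B, (∀ j, y j ∈ A) ∧ ∀ i, ∑ j, r i j • y j = ∑ j, r i j • x j := by
  constructor
  · intro h m n r x hx
    obtain ⟨y, hy⟩ := h m n r (fun i => ⟨_, hx i⟩) ⟨x, fun i => rfl⟩
    exact ⟨fun j => y j, fun j => (y j).2, fun i => by simpa using congrArg Subtype.val (hy i)⟩
  · rintro h m n r a ⟨x, hx⟩
    obtain ⟨y, hy, hyx⟩ := h m n r x (fun i => by rw [hx]; exact (a i).2)
    exact ⟨fun j => ⟨y j, hy j⟩, fun i => Subtype.ext (by simpa [hx] using hyx i)⟩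

/-- Preimages of pure submodules under pure epimorphisms are pure. -/
theorem IsPure.comap_mkQ {B : Type w} [AddCommGroup B] [Module V B] {A : Submodule V B}
    (hA : IsPure A) {D : Submodule V (B ⧸ A)} (hD : IsPure D) : IsPure (D.comap A.mkQ) := by
  rw [isPure_iff] at *
  intro m n r x hx
  obtain ⟨y, hy, hyx⟩ := hD m n r (fun j => A.mkQ (x j)) (fun i => by
    simpa using hx i)
  choose y' hy' using fun j => A.mkQ_surjective (y j)
  -- The lifts `y'` solve the system only modulo A; purity of A corrects the error.
  obtain ⟨z, hz, hzx⟩ := hA m n r (fun j => x j - y' j) (fun i => by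
    rw [← Submodule.ker_mkQ A, LinearMap.mem_ker, map_sum]
    simp only [map_smul, map_sub, hy', smul_sub, Finset.sum_sub_distrib, hyx, sub_self])
  refine ⟨fun j => y' j + z j, fun j => ?_, fun i => ?_⟩
  · rw [Submodule.mem_comap, map_add, hy', LinearMap.mem_ker.1 ((Submodule.ker_mkQ A).symm ▸ hz j),
      add_zero]
    exact hy j
  · simp only [smul_add, Finset.sum_add_distrib, hzx, smul_sub, Finset.sum_sub_distrib]
    abel

end Purity

section Pushout

variable {R : Type*} [Ring R] {N F : Type w} [AddCommGroup N] [Module R N]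
  [AddCommGroup F] [Module R F]

/-- The pushout of the extension `0 → H → F → F ⧸ H → 0` along a homomorphism `H → N`. -/
theorem exists_pushout_extension (H : Submodule R F) (φ : H →ₗ[R] N) :
    ∃ (X : Type w) (_ : AddCommGroup X) (_ : Module R X) (k : N →ₗ[R] X) (u : F →ₗ[R] X)
      (g : X →ₗ[R] F ⧸ H), Function.Injective k ∧ Function.Exact k g ∧ Function.Surjective g ∧
        (∀ h : H, u h = k (φ h)) ∧ ∀ x, g (u x) = H.mkQ x := by
  let d : H →ₗ[R] N × F := φ.prod (-H.subtype)
  let D := LinearMap.range d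
  have hg : D ≤ LinearMap.ker (H.mkQ ∘ₗ LinearMap.snd R N F) := by
    rintro _ ⟨h, rfl⟩
    simp [d]
  refine ⟨(N × F) ⧸ D, inferInstance, inferInstance, D.mkQ ∘ₗ LinearMap.inl R N F,
    D.mkQ ∘ₗ LinearMap.inr R N F, D.liftQ _ hg, ?_, ?_, ?_, fun h => ?_, fun x => by simp⟩
  · rw [injective_iff_map_eq_zero]
    intro n hn
    obtain ⟨h, hh⟩ := (Submodule.Quotient.mk_eq_zero D).1 hn
    have h1 : φ h = n := congrArg Prod.fst hh
    have h2 : -(h : F) = 0 := congrArg Prod.snd hh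
    have h3 : h = 0 := Subtype.ext (neg_eq_zero.1 h2)
    rw [← h1, h3, map_zero]
  · intro x
    obtain ⟨⟨n, f⟩, rfl⟩ := D.mkQ_surjective x
    constructor
    · intro h
      have hf : f ∈ H := by simpa using h
      refine ⟨n + φ ⟨f, hf⟩, ?_⟩
      refine (Submodule.Quotient.eq D).2 ⟨⟨f, hf⟩, ?_⟩
      simp [d]
    · rintro ⟨n', hn'⟩
      rw [← hn']
      simp
  · intro y
    obtain ⟨f, rfl⟩ := H.mkQ_surjective y
    exact ⟨D.mkQ (0, f), by simp⟩
  · refine (Submodule.Quotient.eq D).2 ⟨-h, ?_⟩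
    simp [d]

end Pushout

/-! ### Purity tested by injective modules. -/

section Injectives

variable {V : Type u} [CommRing V]

theorem exists_embedding_into_injective [Small.{w} V] (X : Type w) [AddCommGroup X] [Module V X] :
    ∃ (E : Type w) (_ : AddCommGroup E) (_ : Module V E) (ι : X →ₗ[V] E),
      Module.Injective V E ∧ Function.Injective ι := by
  obtain ⟨⟨J, hJ, f, hf⟩⟩ := EnoughInjectives.presentation (ModuleCat.of V X)
  exact ⟨J, inferInstance, inferInstance, f.hom,
    (Module.injective_iff_injective_object V J).2 hJ, (ModuleCat.mono_iff_injective f).1 hf⟩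

variable {m n : ℕ} (r : Fin m → Fin n → V)

/-- The left sides of a finite system of linear equations, evaluated on a module. -/
def evalSystem (B : Type w) [AddCommGroup B] [Module V B] : (Fin n → B) →ₗ[V] (Fin m → B) :=
  LinearMap.pi fun i => ∑ j, r i j • LinearMap.proj j

/-- The tuples annihilated by the transpose of a matrix. -/
def transposeKernel (E : Type w) [AddCommGroup E] [Module V E] : Submodule V (Fin m → E) where
  carrier := {e | ∀ j, ∑ i, r i j • e i = 0}
  add_mem' ha hb j := by simp [Finset.sum_add_distrib, ha j, hb j]
  zero_mem' j := by simp
  smul_mem' c x hx j := by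
    simp only [Pi.smul_apply, smul_comm _ c, ← Finset.smul_sum, hx j, smul_zero]

variable {A B E : Type w} [AddCommGroup A] [Module V A] [AddCommGroup B] [Module V B]
  [AddCommGroup E] [Module V E]

@[simp] theorem evalSystem_apply (x : Fin n → B) (i : Fin m) :
    evalSystem r B x i = ∑ j, r i j • x j := by
  simp [evalSystem]

/-- Homomorphisms to the module of tuples in an injective module that are annihilated by a matrix
extend along pure monomorphisms. -/
theorem exists_extension_to_transposeKernel [Small.{w} V] (hE : Module.Injective V E)
    (f : A →ₗ[V] B) (hf : Function.Injective f) (hp : IsPure (LinearMap.range f))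
    (χ : A →ₗ[V] transposeKernel r E) :
    ∃ ψ : B →ₗ[V] transposeKernel r E, ∀ a, ψ (f a) = χ a := by
  -- Maps A → `transposeKernel r E` are maps A^m → E vanishing on rA^n. Purity says that A^m ∩ rB^n
  -- = rA^n, so `χ'` extends by zero on rB^n, and then to B^m.
  let χ' : (Fin m → A) →ₗ[V] E :=
    ∑ i, (LinearMap.proj i ∘ₗ (transposeKernel r E).subtype ∘ₗ χ) ∘ₗ LinearMap.proj i
  have hχ' : ∀ a, χ' a = ∑ i, (χ (a i) : Fin m → E) i := fun a => by simp [χ']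
  let p : (Fin m → A) × (Fin n → B) →ₗ[V] (Fin m → B) :=
    (f.compLeft (Fin m)).coprod (evalSystem r B)
  obtain ⟨η, hη⟩ := exists_comp_eq_of_ker_le p.rangeRestrict p.surjective_rangeRestrict
    (χ' ∘ₗ LinearMap.fst V _ _) (by
      rintro ⟨a, y⟩ h
      have h1 : ∀ i, f (a i) + ∑ j, r i j • y j = 0 := fun i => by
        have := congrFun (congrArg Subtype.val h) i
        simpa [p] using this
      obtain ⟨z, hz⟩ := hp m n r (fun i => ⟨f (-a i), ⟨_, rfl⟩⟩)
        ⟨y, fun i => (neg_eq_of_add_eq_zero_right (h1 i)).symm.trans (map_neg f _).symm⟩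
      choose z' hz' using fun j => (z j).2
      have h2 : ∀ i, a i = -∑ j, r i j • z' j := fun i => hf (by
        have h3 : ∑ j, r i j • (z j : B) = f (-a i) := by
          simpa only [Submodule.coe_sum, Submodule.coe_smul] using congrArg Subtype.val (hz i)
        simp only [map_neg, map_sum, map_smul, hz', h3, neg_neg])
      rw [LinearMap.mem_ker, LinearMap.comp_apply, LinearMap.fst_apply, hχ']
      simp only [h2, map_neg, map_sum, map_smul, Submodule.coe_neg, Submodule.coe_sum,
        Submodule.coe_smul, Pi.neg_apply, Finset.sum_apply, Pi.smul_apply]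
      rw [Finset.sum_neg_distrib, Finset.sum_comm, neg_eq_zero]
      exact Finset.sum_eq_zero fun j _ => (χ (z' j)).2 j)
  obtain ⟨θ, hθ⟩ := Module.Injective.extension_property V E _ _ (LinearMap.range p).subtype
    (Submodule.subtype_injective _) η
  have hθp : ∀ a y, θ (p (a, y)) = χ' a := fun a y => by
    have h1 := congrArg (fun l => l (p.rangeRestrict (a, y))) hθ
    have h2 := congrArg (fun l => l (a, y)) hη
    exact h1.trans h2
  let ψ : B →ₗ[V] (Fin m → E) := LinearMap.pi fun i => θ ∘ₗ LinearMap.single V (fun _ => B) i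
  have hψ : ∀ b, ψ b ∈ transposeKernel r E := fun b j => by
    have h1 : ∑ i, r i j • ψ b i = θ (p (0, Pi.single j b)) := by
      simp only [ψ, LinearMap.pi_apply, LinearMap.comp_apply, ← map_smul, ← map_sum]
      congr 1
      ext i
      simp [p, Pi.single_apply]
    rw [h1, hθp, map_zero]
  refine ⟨ψ.codRestrict _ hψ, fun a => Subtype.ext (funext fun i => ?_)⟩
  have h1 : ψ (f a) i = θ (p (Pi.single i a, 0)) := by
    simp only [ψ, LinearMap.pi_apply, LinearMap.comp_apply]
    congr 1
    ext i'
    by_cases h : i' = i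
    · subst h; simp [p]
    · simp [p, h]
  rw [LinearMap.codRestrict_apply, h1, hθp, hχ', Finset.sum_eq_single i]
  · simp
  · intro i' _ h
    simp [h]
  · simp

/-- If homomorphisms into all the modules `transposeKernel r E` with `E` injective extend along
`f`, then finite systems over the source that are solvable in the target are solvable. -/
theorem exists_solution_of_extends_to_transposeKernel [Small.{w} V] (f : A →ₗ[V] B)
    (H : ∀ (E : Type w) [AddCommGroup E] [Module V E], Module.Injective V E →
      ∀ χ : A →ₗ[V] transposeKernel r E, ∃ ψ : B →ₗ[V] transposeKernel r E, ∀ a, ψ (f a) = χ a)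
    (a : Fin m → A) (x : Fin n → B) (hx : ∀ i, ∑ j, r i j • x j = f (a i)) :
    ∃ y : Fin n → A, ∀ i, ∑ j, r i j • y j = a i := by
  -- The universal test: embed A^m/rA^n in an injective module. Once the test map extends to B, the
  -- class of `a` must vanish because `f` sends `a` into rB^n.
  let S := LinearMap.range (evalSystem r A)
  obtain ⟨E, _, _, ι, hE, hι⟩ := exists_embedding_into_injective (V := V) ((Fin m → A) ⧸ S)
  let χ : A →ₗ[V] (Fin m → E) :=
    LinearMap.pi fun i => ι ∘ₗ S.mkQ ∘ₗ LinearMap.single V (fun _ => A) i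
  have hχ : ∀ a, χ a ∈ transposeKernel r E := fun a j => by
    simp only [χ, LinearMap.pi_apply, LinearMap.comp_apply, ← map_smul, ← map_sum]
    refine (congrArg ι ((Submodule.Quotient.mk_eq_zero S).2 ⟨Pi.single j a, ?_⟩)).trans
      (map_zero ι)
    ext i
    simp [Pi.single_apply]
  obtain ⟨ψ, hψ⟩ := H E hE (χ.codRestrict _ hχ)
  have h1 : ι (S.mkQ a) = 0 := by
    have h2 : ι (S.mkQ a) = ∑ i, χ (a i) i := by
      simp only [χ, LinearMap.pi_apply, LinearMap.comp_apply, ← map_sum]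
      congr 2
      exact (LinearMap.sum_single_apply (fun _ => A) a).symm
    have h3 : ∀ i, χ (a i) i = ∑ j, r i j • (ψ (x j) : Fin m → E) i := fun i => by
      have := congrFun (congrArg Subtype.val (hψ (a i))) i
      rw [← hx] at this
      simpa using this.symm
    rw [h2]
    simp only [h3]
    rw [Finset.sum_comm]
    exact Finset.sum_eq_zero fun j _ => (ψ (x j)).2 j
  obtain ⟨y, hy⟩ := (Submodule.Quotient.mk_eq_zero S).1 (hι (h1.trans (map_zero ι).symm))
  exact ⟨y, fun i => by rw [← hy, evalSystem_apply]⟩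

end Injectives

open Limits

/-! ### The small object argument for modules. -/

section SmallObject

/-- Exactness of filtered colimits is inherited from abelian groups through the forgetful functor.
-/
instance isGrothendieckAbelian_moduleCat (R : Type u) [Ring R] :
    IsGrothendieckAbelian.{max u v} (ModuleCat.{max u v} R) := by
  have : AB5 (ModuleCat.{max u v} R) :=
    ⟨fun J _ _ => HasExactColimitsOfShape.domain_of_functor J
      (forget₂ (ModuleCat.{max u v} R) AddCommGrpCat.{max u v})⟩
  exact {}

open MorphismProperty in
/-- In a Grothendieck abelian category, every small family of monomorphisms permits the small
object argument. -/
theorem hasSmallObjectArgument_ofHoms {C : Type u} [Category.{v} C] [Abelian C]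
    [IsGrothendieckAbelian.{w} C] {ι : Type w} {X Y : ι → C} (f : ∀ i, X i ⟶ Y i)
    [∀ i, Mono (f i)] : HasSmallObjectArgument.{w} (ofHoms f) := by
  -- With κ regular and larger than the number of subobjects of each source, maps out of the sources
  -- commute with colimits of κ-chains of monomorphisms. Attaching cells produces only
  -- monomorphisms.
  obtain ⟨κ, hκ', hκ⟩ := HasCardinalLT.exists_regular_cardinal_forall.{w}
    (fun i => Subobject (X i))
  have : Fact κ.IsRegular := ⟨hκ'⟩
  have : Nonempty κ.ord.ToType := by simpa using hκ'.ne_zero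
  have := WellFoundedLT.toOrderBot κ.ord.ToType
  have hmono : ofHoms f ≤ monomorphisms C := by
    rintro _ _ _ ⟨i⟩
    exact inferInstanceAs (Mono (f i))
  exact ⟨κ, inferInstance, inferInstance,
    { preservesColimit {A B X Y} i hi f hf := by
        let hf' : (monomorphisms C).TransfiniteCompositionOfShape κ.ord.ToType f :=
          { toTransfiniteCompositionOfShape := hf.toTransfiniteCompositionOfShape
            map_mem j hj := by
              have := (hf.attachCells j hj).pushouts_coproducts
              simp only [ofHoms_homFamily] at this
              refine (?_ : _ ≤ monomorphisms C) _ this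
              simp only [pushouts_le_iff, coproducts_le_iff]
              exact hmono }
        have (j j' : κ.ord.ToType) (φ : j ⟶ j') : Mono (hf'.F.map φ) := hf'.mem_map φ
        apply IsGrothendieckAbelian.preservesColimit_coyoneda_obj_of_mono (Y := hf'.F) (κ := κ)
        obtain ⟨i⟩ := hi
        exact hκ i }⟩

end SmallObject

/-! ### Pure-tight monomorphisms and lifting properties. -/

section PureTight

variable (V : Type u) [CommRing V]

/-- The monomorphisms whose image is pure and tight. -/
def pureTightMonomorphisms : MorphismProperty (ModuleCat.{w} V) := fun _ _ f =>
  Function.Injective f.hom ∧ IsPure (LinearMap.range f.hom) ∧ IsTight (LinearMap.range f.hom)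

variable {V}

/-- Surjections whose kernel is a quotient of an injective module have the right lifting property
with respect to monomorphisms with tight image. -/
theorem exists_lift_of_isTight {A B E G Q Y : Type (max u v)} [AddCommGroup A] [Module V A]
    [AddCommGroup B] [Module V B] [AddCommGroup E] [Module V E] [AddCommGroup G] [Module V G]
    [AddCommGroup Q] [Module V Q] [AddCommGroup Y] [Module V Y]
    (f : A →ₗ[V] B) (hf : Function.Injective f) (ht : IsTight (LinearMap.range f))
    (k : Y →ₗ[V] E) (hk : Function.Injective k) (π : E →ₗ[V] G) (hkπ : Function.Exact k π)
    (hπ : Function.Surjective π) (hQ : Module.Injective V Q) (q : Q →ₗ[V] Y)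
    (hq : Function.Surjective q) (s : A →ₗ[V] E) (t : B →ₗ[V] G) (hst : ∀ a, π (s a) = t (f a)) :
    ∃ l : B →ₗ[V] E, (∀ a, l (f a) = s a) ∧ ∀ b, π (l b) = t b := by
  -- P is the pullback of `t` and `π`; it contains A × Y with quotient B/A. Extending the projection
  -- A × Y → Y to `ρ` on P, the map (b, x) ↦ x - k(ρ(b, x)) no longer depends on x and is the lift.
  let P : Submodule V (B × E) :=
    LinearMap.ker (t ∘ₗ LinearMap.fst V B E - π ∘ₗ LinearMap.snd V B E)
  have hP : ∀ x, x ∈ P ↔ t x.1 = π x.2 := fun x => by simp [P, sub_eq_zero]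
  let j : A × Y →ₗ[V] P := ((f ∘ₗ LinearMap.fst V A Y).prod (s.coprod k)).codRestrict P (by
    rintro ⟨a, y⟩
    simp [hP, hst, hkπ.apply_apply_eq_zero])
  have hj : ∀ a y, (j (a, y) : B × E) = (f a, s a + k y) := fun a y => by simp [j]
  have hji : Function.Injective j := by
    rw [injective_iff_map_eq_zero]
    rintro ⟨a, y⟩ h
    have h1 : (f a, s a + k y) = 0 := (hj a y).symm.trans (congrArg Subtype.val h)
    have ha : a = 0 := hf ((congrArg Prod.fst h1).trans (map_zero f).symm)
    subst ha
    have hy : y = 0 := hk (by simpa using congrArg Prod.snd h1)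
    rw [hy]; rfl
  let e : P →ₗ[V] B ⧸ LinearMap.range f :=
    (LinearMap.range f).mkQ ∘ₗ LinearMap.fst V B E ∘ₗ P.subtype
  have he : Function.Surjective e := fun b => by
    obtain ⟨b, rfl⟩ := (LinearMap.range f).mkQ_surjective b
    obtain ⟨x, hx⟩ := hπ (t b)
    exact ⟨⟨(b, x), (hP _).2 hx.symm⟩, rfl⟩
  have hker : LinearMap.ker e = LinearMap.range j := by
    ext ⟨⟨b, x⟩, hx⟩
    rw [LinearMap.mem_ker]
    refine (Submodule.Quotient.mk_eq_zero (LinearMap.range f)).trans ⟨?_, ?_⟩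
    · rintro ⟨a, rfl⟩
      have hx' : t (f a) = π x := (hP _).1 hx
      obtain ⟨y, hy⟩ := (hkπ (x - s a)).1 (by rw [map_sub, hst, hx', sub_self])
      exact ⟨(a, y), Subtype.ext (by rw [hj, hy]; simp)⟩
    · rintro ⟨⟨a, y⟩, h⟩
      exact ⟨a, congrArg Prod.fst ((hj a y).symm.trans (congrArg Subtype.val h))⟩
  obtain ⟨ρ, hρ⟩ := exists_extension_to_quotient_of_injective.{u, v} j hji
    (IsObject.congr ((e.quotKerEquivOfSurjective he).symm.trans
      (Submodule.quotEquivOfEq _ _ hker)) ht) hQ q hq (LinearMap.snd V A Y)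
  have hρ' : ∀ a y, ρ (j (a, y)) = y := fun a y => congrArg (fun l => l (a, y)) hρ
  obtain ⟨l, hl⟩ := exists_comp_eq_of_ker_le (LinearMap.fst V B E ∘ₗ P.subtype)
    (fun b => by
      obtain ⟨x, hx⟩ := hπ (t b)
      exact ⟨⟨(b, x), (hP _).2 hx.symm⟩, rfl⟩)
    (LinearMap.snd V B E ∘ₗ P.subtype - k ∘ₗ ρ) (by
      rintro ⟨⟨b, x⟩, hx⟩ hb
      have hb : b = 0 := hb
      subst hb
      obtain ⟨y, hy⟩ := (hkπ x).1 (by rw [← (hP _).1 hx, map_zero])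
      have h1 : (⟨(0, x), hx⟩ : P) = j (0, y) := Subtype.ext (by rw [hj, hy]; simp)
      rw [LinearMap.mem_ker, LinearMap.sub_apply, LinearMap.comp_apply k, h1, hρ', hy, ← h1]
      exact sub_self x)
  have hl' : ∀ p : P, l p.1.1 = p.1.2 - k (ρ p) := fun p => congrArg (fun l => l p) hl
  refine ⟨l, fun a => ?_, fun b => ?_⟩
  · have h1 := hl' (j (a, 0))
    rw [hρ', map_zero, sub_zero, hj] at h1
    simpa using h1
  · obtain ⟨x, hx⟩ := hπ (t b)
    have h1 := hl' ⟨(b, x), (hP _).2 hx.symm⟩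
    rw [h1, map_sub, hkπ.apply_apply_eq_zero, sub_zero, hx]

/-- A module is projective if its homomorphisms lift along the quotient maps of injective
modules. -/
theorem projective_of_lifts_from_quotients_of_injective {K : Type (max u v)} [AddCommGroup K]
    [Module V K]
    (H : ∀ (Q : Type (max u v)) [AddCommGroup Q] [Module V Q] (L : Submodule V Q),
      Module.Injective V Q → ∀ φ : K →ₗ[V] Q ⧸ L, ∃ θ : K →ₗ[V] Q, ∀ z, L.mkQ (θ z) = φ z) :
    Module.Projective V K := by
  refine Module.Projective.of_lifting_property'' fun σ hσ => ?_
  obtain ⟨Q, _, _, e, hQ, he⟩ := exists_embedding_into_injective.{u, max u v} (V := V) (K →₀ V)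
  -- K becomes the submodule e(free)/L of Q/L. A lift of this inclusion to Q stays inside e(free)
  -- because L does, and so yields a section of `σ`.
  let L : Submodule V Q := (LinearMap.ker σ).map e
  obtain ⟨φ, hφ⟩ := exists_comp_eq_of_ker_le σ hσ (L.mkQ ∘ₗ e) (fun x hx =>
    (Submodule.Quotient.mk_eq_zero L).2 ⟨x, hx, rfl⟩)
  have hφ' : ∀ w, φ (σ w) = L.mkQ (e w) := fun w => congrArg (fun l => l w) hφ
  obtain ⟨θ, hθ⟩ := H Q L hQ φ
  have key : ∀ z : K, ∃ w, e w = θ z ∧ σ w = z := fun z => by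
    obtain ⟨w, hw⟩ := hσ z
    have h1 : L.mkQ (θ z) = L.mkQ (e w) := by rw [hθ, ← hφ', hw]
    obtain ⟨w', hw', h2⟩ := (Submodule.Quotient.eq L).1 h1
    exact ⟨w' + w, by rw [map_add, h2, sub_add_cancel],
      by rw [map_add, LinearMap.mem_ker.1 hw', hw, zero_add]⟩
  obtain ⟨s, hs⟩ := exists_comp_eq_of_range_le e he θ (by
    rintro _ ⟨z, rfl⟩
    obtain ⟨w, hw, -⟩ := key z
    exact ⟨w, hw⟩)
  refine ⟨s, LinearMap.ext fun z => ?_⟩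
  obtain ⟨w, hw, hwz⟩ := key z
  have h1 : s z = w := he ((congrArg (fun l => l z) hs).trans hw.symm)
  rw [LinearMap.comp_apply, h1, hwz]; rfl

/-- A module is an object if every surjection onto it whose kernel is a quotient of an injective
module splits. -/
theorem isObject_of_splits {C : Type (max u v)} [AddCommGroup C] [Module V C]
    (H : ∀ (E Q Y : Type (max u v)) [AddCommGroup E] [Module V E] [AddCommGroup Q] [Module V Q]
      [AddCommGroup Y] [Module V Y] (k : Y →ₗ[V] E) (π : E →ₗ[V] C) (q : Q →ₗ[V] Y),
      Function.Injective k → Function.Exact k π → Function.Surjective π → Module.Injective V Q →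
      Function.Surjective q → ∃ l : C →ₗ[V] E, ∀ c, π (l c) = c) : IsObject V C := by
  obtain ⟨F, _, _, p, hF, hp⟩ : ∃ (F : Type (max u v)) (_ : AddCommGroup F) (_ : Module V F)
      (p : F →ₗ[V] C), Module.Projective V F ∧ Function.Surjective p :=
    ⟨C →₀ V, inferInstance, inferInstance, Finsupp.linearCombination V (id : C → C),
      inferInstance, Finsupp.linearCombination_id_surjective V C⟩
  let K := LinearMap.ker p
  suffices Module.Projective V K from
    isObject_of_projective_ker.{u, v} (K := K) p K.subtype
      K.subtype_injective p.exact_subtype_ker_map hp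
  refine projective_of_lifts_from_quotients_of_injective.{u, v} fun Q _ _ L hQ φ => ?_
  -- A splitting of the extension pushed out along `φ` extends `φ` to the projective module F, from
  -- which it lifts to Q.
  obtain ⟨E, _, _, k, i, g, hk, hkg, hg, hik, hgi⟩ := exists_pushout_extension K φ
  let c := p.quotKerEquivOfSurjective hp
  obtain ⟨l, hl⟩ := H E Q (Q ⧸ L) k (c.toLinearMap ∘ₗ g) L.mkQ hk
    (fun x => by simpa using hkg x) (c.surjective.comp hg) hQ L.mkQ_surjective
  obtain ⟨ρ, hρ⟩ := exists_comp_eq_of_range_le k hk (i - l ∘ₗ p) (by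
    rintro _ ⟨x, rfl⟩
    refine (hkg _).1 (c.injective ?_)
    rw [LinearMap.sub_apply, map_sub, map_sub, map_zero, hgi, sub_eq_zero]
    exact (hl (p x)).symm)
  have hρ' : ∀ x, k (ρ x) = i x - l (p x) := fun x => congrArg (fun l => l x) hρ
  obtain ⟨θ, hθ⟩ := Module.projective_lifting_property L.mkQ ρ L.mkQ_surjective
  refine ⟨θ ∘ₗ K.subtype, fun z => hk ?_⟩
  have hθ' : L.mkQ (θ z) = ρ z := congrArg (fun l => l z) hθ
  exact (congrArg k hθ').trans (by rw [hρ', hik, LinearMap.mem_ker.1 z.2, map_zero, sub_zero])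

/-- The pure monomorphisms with tight image are closed under the operations under which the left
lifting property is stable. -/
theorem llp_rlp_pureTightMonomorphisms_le :
    (pureTightMonomorphisms.{u, max u v} V).rlp.llp ≤ pureTightMonomorphisms V := by
  intro A B f hf
  have hsol := fun (m n : ℕ) (r : Fin m → Fin n → V) =>
    exists_solution_of_extends_to_transposeKernel r f.hom (by
      intro E _ _ hE χ
      have hD : (pureTightMonomorphisms.{u, max u v} V).rlp
          (0 : ModuleCat.of V (transposeKernel r E) ⟶ ModuleCat.of V PUnit.{max u v + 1}) := by
        intro A B f hf
        refine ⟨fun {s t} sq => ?_⟩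
        obtain ⟨ψ, hψ⟩ := exists_extension_to_transposeKernel r hE f.hom hf.1 hf.2.1 s.hom
        exact ⟨⟨ModuleCat.ofHom ψ, ModuleCat.hom_ext (LinearMap.ext hψ), by ext⟩⟩
      have := hf _ hD
      have sq : CommSq (ModuleCat.ofHom χ) f
        (0 : ModuleCat.of V (transposeKernel r E) ⟶ ModuleCat.of V PUnit.{max u v + 1}) 0 :=
        ⟨by simp⟩
      exact ⟨sq.lift.hom, fun a => congrArg (fun l => l.hom a) sq.fac_left⟩)
  have hinj : Function.Injective f.hom := by
    rw [injective_iff_map_eq_zero]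
    intro a ha
    -- One equation in no unknowns: `0 = a` holds in B, hence in A.
    obtain ⟨y, hy⟩ := hsol 1 0 (fun _ => Fin.elim0) (fun _ => a) Fin.elim0 (by simp [ha])
    simpa using (hy 0).symm
  refine ⟨hinj, ?_, isObject_of_splits.{u, v} ?_⟩
  · rintro m n r a ⟨x, hx⟩
    choose a' ha' using fun i => (a i).2
    obtain ⟨y, hy⟩ := hsol m n r a' x (fun i => (hx i).trans (ha' i).symm)
    refine ⟨fun j => ⟨f.hom (y j), ⟨_, rfl⟩⟩, fun i => Subtype.ext ?_⟩
    rw [← ha', ← hy]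
    simp
  · intro E Q Y _ _ _ _ _ _ k π q hk hkπ hπ hQ hq
    have hE : (pureTightMonomorphisms.{u, max u v} V).rlp (ModuleCat.ofHom π) := by
      intro A B f hf
      refine ⟨fun {s t} sq => ?_⟩
      obtain ⟨l, hl, hl'⟩ := exists_lift_of_isTight.{u, v} f.hom hf.1 hf.2.2 k hk π hkπ hπ hQ q hq
        s.hom t.hom (fun a => congrArg (fun l => l.hom a) sq.w)
      exact ⟨⟨ModuleCat.ofHom l, ModuleCat.hom_ext (LinearMap.ext hl),
        ModuleCat.hom_ext (LinearMap.ext hl')⟩⟩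
    have := hf _ hE
    -- The lift in this square kills A, so it descends to a section of `π` on the cokernel.
    have sq : CommSq (0 : A ⟶ ModuleCat.of V E) f (ModuleCat.ofHom π)
        (ModuleCat.ofHom (LinearMap.range f.hom).mkQ) :=
      ⟨by
        ext a
        simpa using ((Submodule.Quotient.mk_eq_zero (LinearMap.range f.hom)).2 ⟨a, rfl⟩).symm⟩
    obtain ⟨l, hl⟩ := exists_comp_eq_of_ker_le (LinearMap.range f.hom).mkQ
      (Submodule.mkQ_surjective _) sq.lift.hom (by
        rw [Submodule.ker_mkQ]
        rintro _ ⟨a, rfl⟩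
        exact congrArg (fun l => l.hom a) sq.fac_left)
    refine ⟨l, fun c => ?_⟩
    obtain ⟨b, rfl⟩ := Submodule.mkQ_surjective _ c
    have h1 : l ((LinearMap.range f.hom).mkQ b) = sq.lift.hom b := congrArg (fun l => l b) hl
    rw [h1]
    exact congrArg (fun l => l.hom b) sq.fac_right

end PureTight

open Cardinal

/-! ### Closing off sets of bounded cardinality. -/

section Cardinality

variable {κ : Cardinal.{w}}

theorem mk_iUnion_le_of_le {ι : Type w'} {α : Type w} (hκ : ℵ₀ ≤ κ) (f : ι → Set α)
    (hι : lift.{w} #ι ≤ lift.{w'} κ) (hf : ∀ i, #(f i) ≤ κ) : #(⋃ i, f i) ≤ κ := by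
  rw [← lift_le.{w'}]
  calc lift.{w'} #(⋃ i, f i) ≤ sum fun i => #(f i) := mk_iUnion_le_sum_mk_lift
    _ ≤ sum fun _ : ι => κ := sum_le_sum _ _ hf
    _ = lift.{w} #ι * lift.{w'} κ := by rw [sum_const]
    _ ≤ lift.{w'} κ * lift.{w'} κ := by gcongr
    _ = lift.{w'} κ := mul_eq_self (by simpa using hκ)

theorem lift_mk_nat_le (hκ : ℵ₀ ≤ κ) : lift.{w} #ℕ ≤ lift.{0} κ := by
  simpa using hκ

theorem lift_mk_pi_fin_le (hκ : ℵ₀ ≤ κ) {X : Type w'} (hX : lift.{w} #X ≤ lift.{w'} κ) (n : ℕ) :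
    lift.{w} #(Fin n → X) ≤ lift.{w'} κ := by
  rw [mk_pi, prod_const, lift_power, mk_fin]
  simp only [lift_natCast, lift_id']
  have hκ' : ℵ₀ ≤ lift.{w'} κ := by simpa using hκ
  exact (power_le_power_right hX).trans (power_nat_le hκ')

/-- A small set is contained in a small set that is closed under a given small-valued finitary
operation. -/
theorem exists_closed_superset {α : Type w} (hκ : ℵ₀ ≤ κ) (Φ : Finset α → Set α)
    (hΦ : ∀ t, #(Φ t) ≤ κ) (S : Set α) (hS : #S ≤ κ) :
    ∃ S', S ⊆ S' ∧ #S' ≤ κ ∧ ∀ t : Finset α, ↑t ⊆ S' → Φ t ⊆ S' := by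
  classical
  -- Countably many rounds suffice, since a finite subset of the union lies in one stage. Finite
  -- subsets are enumerated by tuples so that they can be counted.
  let step : Set α → Set α := fun T =>
    T ∪ ⋃ (n : ℕ) (x : Fin n → T), Φ (Finset.univ.image fun i => (x i : α))
  have hstep : ∀ T : Set α, #T ≤ κ → #(step T) ≤ κ := fun T hT => by
    refine (mk_union_le _ _).trans ((add_le_add hT ?_).trans_eq (add_eq_self hκ))
    exact mk_iUnion_le_of_le hκ _ (lift_mk_nat_le hκ) fun n =>
      mk_iUnion_le_of_le hκ _ (lift_mk_pi_fin_le hκ (lift_le.2 hT) n) fun x => hΦ _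
  have hmono : Monotone fun n => step^[n] S := monotone_nat_of_le_succ fun n => by
    rw [Function.iterate_succ_apply']
    exact Set.subset_union_left
  refine ⟨⋃ n, step^[n] S, Set.subset_iUnion (fun n => step^[n] S) 0,
    mk_iUnion_le_of_le hκ _ (lift_mk_nat_le hκ) fun n => ?_, fun t ht => ?_⟩
  · induction n with
    | zero => exact hS
    | succ n ih => rw [Function.iterate_succ_apply']; exact hstep _ ih
  · obtain ⟨n, hn⟩ := hmono.directed_le.exists_mem_subset_of_finset_subset_biUnion ht
    refine subset_trans ?_ (Set.subset_iUnion _ (n + 1))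
    rw [Function.iterate_succ_apply']
    refine subset_trans ?_ Set.subset_union_right
    refine subset_trans ?_ (Set.subset_iUnion₂ t.card fun i => ⟨(t.equivFin.symm i : α),
      hn (t.equivFin.symm i).2⟩)
    refine (congrArg Φ ?_).subset
    ext a
    simp only [Finset.mem_image, Finset.mem_univ, true_and]
    exact ⟨fun h => ⟨t.equivFin ⟨a, h⟩, by simp⟩, by rintro ⟨i, rfl⟩; exact (t.equivFin.symm i).2⟩

theorem mk_span_le_of_le {V : Type u} [CommRing V] {B : Type w} [AddCommGroup B] [Module V B]
    (hκ : ℵ₀ ≤ κ) (hV : lift.{w} #V ≤ lift.{u} κ) (S : Set B) (hS : #S ≤ κ) :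
    #(Submodule.span V S) ≤ κ := by
  have h : (Submodule.span V S : Set B) ⊆
      ⋃ (n : ℕ) (r : Fin n → V) (x : Fin n → S), {∑ i, r i • (x i : B)} := fun b hb => by
    obtain ⟨n, r, x, h⟩ := Submodule.mem_span_set'.1 hb
    simp only [Set.mem_iUnion]
    exact ⟨n, r, x, h.symm⟩
  refine (mk_le_mk_of_subset h).trans ?_
  exact mk_iUnion_le_of_le hκ _ (lift_mk_nat_le hκ) fun n =>
    mk_iUnion_le_of_le hκ _ (lift_mk_pi_fin_le hκ hV n) fun r =>
      mk_iUnion_le_of_le hκ _ (lift_mk_pi_fin_le hκ (lift_le.2 hS) n) fun x =>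
        (mk_singleton _).trans_le (one_le_aleph0.trans hκ)

end Cardinality

/-! ### The embedding, and extension when the quotient is small. -/

section PureInjectiveExtension

variable {V : Type u} [CommRing V]

theorem IsPure.comap_equiv {B B' : Type w} [AddCommGroup B] [Module V B] [AddCommGroup B']
    [Module V B'] (e : B' ≃ₗ[V] B) {A : Submodule V B} (hA : IsPure A) :
    IsPure (A.comap e.toLinearMap) := by
  rw [isPure_iff] at *
  intro m n r x hx
  obtain ⟨y, hy, hyx⟩ := hA m n r (fun j => e (x j)) (fun i => by
    simpa using hx i)
  refine ⟨fun j => e.symm (y j), fun j => by simpa using hy j, fun i => e.injective ?_⟩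
  simpa using hyx i

theorem IsTight.comap_equiv {B B' : Type w} [AddCommGroup B] [Module V B] [AddCommGroup B']
    [Module V B'] (e : B' ≃ₗ[V] B) {A : Submodule V B} (hA : IsTight A) :
    IsTight (A.comap e.toLinearMap) :=
  IsObject.congr (Submodule.Quotient.equiv _ _ e (by
    rw [Submodule.map_comap_eq_of_surjective e.surjective])).symm hA

variable (κ : Cardinal.{w})

variable (V) in
/-- Homomorphisms from pure tight submodules of modules of cardinality at most `κ` extend. -/
def ExtendsFromSmall (N : Type w) [AddCommGroup N] [Module V N] : Prop :=
  ∀ (P : Type w) [AddCommGroup P] [Module V P], #P ≤ κ → ∀ K : Submodule V P, IsPure K →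
    IsTight K → ∀ h : K →ₗ[V] N, ∃ g : P →ₗ[V] N, ∀ z : K, g z = h z

variable (V) in
/-- The pure tight submodules of the quotients of a free module. -/
structure PureTightPair (Ω : Type w) where
  /-- The relations of the ambient module. -/
  relations : Submodule V (Ω →₀ V)
  /-- The submodule. -/
  sub : Submodule V ((Ω →₀ V) ⧸ relations)
  isPure : IsPure sub
  isTight : IsTight sub

/-- Every module is a pure tight submodule of one to which homomorphisms extend from the pure
tight submodules of modules of bounded cardinality. -/
theorem exists_pureTight_embedding (κ : Cardinal.{max u v}) (M : Type (max u v)) [AddCommGroup M]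
    [Module V M] :
    ∃ (N : Type (max u v)) (_ : AddCommGroup N) (_ : Module V N) (f : M →ₗ[V] N),
      Function.Injective f ∧ IsPure (LinearMap.range f) ∧ IsTight (LinearMap.range f) ∧
        ExtendsFromSmall V κ N := by
  -- Every module of cardinality at most κ is a quotient of the free module on Ω, so the pairs below
  -- form a set of representatives.
  let Ω := κ.out
  let i : ∀ p : PureTightPair V Ω, ModuleCat.of V p.sub ⟶ ModuleCat.of V ((Ω →₀ V) ⧸ p.relations) :=
    fun p => ModuleCat.ofHom p.sub.subtype
  have : ∀ p, Mono (i p) := fun p => (ModuleCat.mono_iff_injective _).2 p.sub.subtype_injective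
  let I := MorphismProperty.ofHoms i
  have hI : I ≤ pureTightMonomorphisms.{u, max u v} V := by
    rintro _ _ _ ⟨p⟩
    refine ⟨p.sub.subtype_injective, ?_, ?_⟩
    · rw [ModuleCat.hom_ofHom, Submodule.range_subtype]; exact p.isPure
    · rw [ModuleCat.hom_ofHom, Submodule.range_subtype]; exact p.isTight
  have : MorphismProperty.HasSmallObjectArgument.{max u v} I := hasSmallObjectArgument_ofHoms i
  let d := MorphismProperty.factorizationData I.rlp.llp I.rlp
    (0 : ModuleCat.of V M ⟶ ModuleCat.of V PUnit.{max u v + 1})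
  have hd := llp_rlp_pureTightMonomorphisms_le.{u, v} _
    (MorphismProperty.antitone_llp (MorphismProperty.antitone_rlp hI) _ d.hi)
  refine ⟨d.Z, inferInstance, inferInstance, d.i.hom, hd.1, hd.2.1, hd.2.2, ?_⟩
  intro P _ _ hP K hK hK' h
  obtain ⟨ω, hω⟩ : ∃ ω : Ω → P, Function.Surjective ω := by
    rw [← mk_out κ] at hP
    obtain ⟨e⟩ := hP
    exact ⟨Function.invFun e, Function.invFun_surjective e.injective⟩
  let q := Finsupp.linearCombination V ω
  have hq : Function.Surjective q := (LinearMap.range_eq_top).1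
    ((Finsupp.range_linearCombination V).trans (by rw [hω.range_eq, Submodule.span_univ]))
  let e := q.quotKerEquivOfSurjective hq
  let p : PureTightPair V Ω :=
    ⟨LinearMap.ker q, K.comap e.toLinearMap, hK.comap_equiv e, hK'.comap_equiv e⟩
  have := d.hp _ (MorphismProperty.ofHoms.mk (f := i) p)
  let h' : ModuleCat.of V p.sub ⟶ d.Z :=
    ModuleCat.ofHom (h ∘ₗ (e.toLinearMap ∘ₗ p.sub.subtype).codRestrict K (fun z => z.2))
  have sq : CommSq h' (i p) d.p 0 := ⟨by ext⟩
  refine ⟨sq.lift.hom ∘ₗ e.symm.toLinearMap, fun z => ?_⟩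
  have h1 := congrArg (fun l => l.hom ⟨e.symm z, by simp [p]⟩) sq.fac_left
  refine Eq.trans h1 (congrArg h (Subtype.ext ?_))
  exact e.apply_symm_apply z

/-- Extension from pure tight submodules with quotient of bounded cardinality. -/
theorem ExtendsFromSmall.exists_extension {κ : Cardinal.{w}} (hκ : ℵ₀ ≤ κ)
    (hV : lift.{w} #V ≤ lift.{u} κ) {N : Type w} [AddCommGroup N] [Module V N]
    (hN : ExtendsFromSmall V κ N) {B : Type w} [AddCommGroup B] [Module V B] (A : Submodule V B)
    (hA : IsPure A) (hA' : IsTight A) (hB : #(B ⧸ A) ≤ κ) (h : A →ₗ[V] N) :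
    ∃ g : B →ₗ[V] N, ∀ a : A, g a = h a := by
  classical
  rw [isPure_iff] at hA
  have hA₂ : ∀ (m n : ℕ) (r : Fin m → Fin n → V) (x : Fin n → B), ∃ y : Fin n → B,
      (∀ i, ∑ j, r i j • x j ∈ A) →
        (∀ j, y j ∈ A) ∧ ∀ i, ∑ j, r i j • y j = ∑ j, r i j • x j := fun m n r x => by
    by_cases hx : ∀ i, ∑ j, r i j • x j ∈ A
    · obtain ⟨y, hy⟩ := hA m n r x hx
      exact ⟨y, fun _ => hy⟩
    · exact ⟨0, fun h => absurd h hx⟩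
  choose y hy using hA₂
  let Φ : Finset B → Set B := fun t => (Submodule.span V (t : Set B) : Set B) ∪
    ⋃ (m : ℕ) (n : ℕ) (r : Fin m → Fin n → V) (x : Fin n → t),
      Set.range (y m n r fun j => (x j : B))
  have hfin : ∀ {β : Type w} [Finite β], #β ≤ κ := fun {β} _ => (mk_le_aleph0).trans hκ
  have hΦ : ∀ t, #(Φ t) ≤ κ := fun t => by
    refine (mk_union_le _ _).trans ((add_le_add (mk_span_le_of_le hκ hV _ hfin)
      ?_).trans_eq (add_eq_self hκ))
    exact mk_iUnion_le_of_le hκ _ (lift_mk_nat_le hκ) fun m =>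
      mk_iUnion_le_of_le hκ _ (lift_mk_nat_le hκ) fun n =>
      mk_iUnion_le_of_le hκ _ (lift_mk_pi_fin_le hκ (lift_mk_pi_fin_le hκ hV n) m) fun r =>
      mk_iUnion_le_of_le hκ _ (lift_le.2 hfin) fun x => hfin
  -- Representatives of B/A are closed under spans and under the chosen solutions in A. This gives a
  -- small P with A + P = B and A ∩ P pure in P; moreover P/(A ∩ P) ≅ B/A.
  obtain ⟨S, hS, hSκ, hSΦ⟩ := exists_closed_superset hκ Φ hΦ
    (Set.range (Quotient.out : B ⧸ A → B)) (mk_range_le.trans hB)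
  have hspan : Submodule.span V S ≤ S := fun b hb => by
    obtain ⟨t, ht, hb⟩ := Submodule.mem_span_finite_of_mem_span hb
    exact hSΦ t ht (Or.inl hb)
  let P := Submodule.span V S
  let K : Submodule V P := A.comap P.subtype
  have hK : IsPure K := by
    rw [isPure_iff]
    intro m n r x hx
    have hx' : ∀ i, ∑ j, r i j • (x j : B) ∈ A := fun i => by simpa [K] using hx i
    have hyP : ∀ j, y m n r (fun j => x j) j ∈ P := fun j => Submodule.subset_span
      (hSΦ (Finset.univ.image fun j => (x j : B)) (by
          intro b hb
          obtain ⟨j, -, rfl⟩ := Finset.mem_image.1 hb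
          exact hspan (x j).2)
        (Or.inr (by
          simp only [Set.mem_iUnion]
          exact ⟨m, n, r, fun j => ⟨x j, Finset.mem_image_of_mem _ (Finset.mem_univ j)⟩, j, rfl⟩)))
    obtain ⟨h1, h2⟩ := hy m n r (fun j => x j) hx'
    exact ⟨fun j => ⟨_, hyP j⟩, h1, fun i => Subtype.ext (by simpa using h2 i)⟩
  have hsurj : ∀ b, ∃ p : P, A.mkQ p = b := fun b =>
    ⟨⟨Quotient.out b, Submodule.subset_span (hS ⟨b, rfl⟩)⟩, Quotient.out_eq b⟩
  have hK' : IsTight K := by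
    refine IsObject.congr (((Submodule.quotEquivOfEq _ _ ?_).trans
      ((A.mkQ ∘ₗ P.subtype).quotKerEquivOfSurjective hsurj)).symm) hA'
    rw [LinearMap.ker_comp, Submodule.ker_mkQ]
  obtain ⟨g₀, hg₀⟩ := hN P ((mk_le_mk_of_subset hspan).trans hSκ) K hK hK'
    (h ∘ₗ (P.subtype ∘ₗ K.subtype).codRestrict A fun z => z.2)
  -- B is the pushout of A and P over A ∩ P, so `h` and `g₀` glue.
  obtain ⟨g, hg⟩ := exists_comp_eq_of_ker_le (A.subtype.coprod P.subtype) (fun b => by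
      obtain ⟨p, hp⟩ := hsurj (A.mkQ b)
      exact ⟨(⟨b - p, (Submodule.Quotient.eq A).1 hp.symm⟩, p), by simp⟩)
    (h.coprod g₀) (by
      rintro ⟨a, p⟩ hap
      have hap : (a : B) + p = 0 := by simpa using hap
      have hp : (p : B) = ((-a : A) : B) := by
        rw [Submodule.coe_neg]; exact (neg_eq_of_add_eq_zero_right hap).symm
      have h1 := hg₀ ⟨p, show (p : B) ∈ A by rw [hp]; exact (-a).2⟩
      have h2 : g₀ p = h (-a) := h1.trans (congrArg h (Subtype.ext hp))
      simp [h2])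
  exact ⟨g, fun a => by simpa using congrArg (fun l => l (a, 0)) hg⟩

end PureInjectiveExtension

/-! ### Sets compatible with a section of the cover of the relation module. -/

section ClosedSets

theorem exists_fin_sum_of_mem_supported {V : Type u} [CommRing V] {C : Type w} {S : Set C}
    {f : C →₀ V}
    (hf : f ∈ Finsupp.supported V V S) :
    ∃ (n : ℕ) (r : Fin n → V) (x : Fin n → S), f = ∑ i, Finsupp.single (x i : C) (r i) := by
  rw [Finsupp.supported_eq_span_single, Submodule.mem_span_set'] at hf
  obtain ⟨n, r, x, rfl⟩ := hf
  choose y hy hyx using fun i => (x i).2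
  exact ⟨n, r, fun i => ⟨y i, hy i⟩, Finset.sum_congr rfl fun i _ => by simp [← hyx]⟩

variable {V : Type u} [CommRing V] {C : Type w} [AddCommGroup C] [Module V C]

variable (V C) in
/-- The module of linear relations between the elements of a module. -/
noncomputable abbrev relationModule : Submodule V (C →₀ V) :=
  LinearMap.ker (Finsupp.linearCombination V (id : C → C))

variable (s : relationModule V C →ₗ[V] (relationModule V C →₀ V))

/-- Given a section `s` of the canonical free cover of the module of relations, a set `X` is closed
if its span is pure and `s` maps relations between elements of `X` to combinations of such
relations. -/
structure IsClosedSet (X : Set C) : Prop where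
  isPure : IsPure (Submodule.span V X)
  section_mem : ∀ z : relationModule V C, (z : C →₀ V) ∈ Finsupp.supported V V X →
    ∀ y ∈ (s z).support, (y : C →₀ V) ∈ Finsupp.supported V V X

theorem isClosedSet_empty : IsClosedSet s (∅ : Set C) where
  isPure := by
    rw [isPure_iff, Submodule.span_empty]
    intro m n r x hx
    refine ⟨0, fun j => Submodule.zero_mem _, fun i => ?_⟩
    simpa using ((Submodule.mem_bot V).1 (hx i)).symm
  section_mem z hz y hy := by
    have h : z = 0 := Subtype.ext (by simpa using hz)
    simp [h] at hy

/-- Both conditions are finitary: the right sides of a finite system, or the support of one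
relation, already live over a single member of the family. -/
theorem isClosedSet_sUnion {c : Set (Set C)} (hc : DirectedOn (· ⊆ ·) c) (hne : c.Nonempty)
    (h : ∀ X ∈ c, IsClosedSet s X) : IsClosedSet s (⋃₀ c) := by
  classical
  constructor
  · rw [isPure_iff]
    intro m n r x hx
    choose t ht hxt using fun i => Submodule.mem_span_finite_of_mem_span (hx i)
    obtain ⟨X, hX, htX⟩ := hc.exists_mem_subset_of_finite_of_subset_sUnion hne
      (s := ((Finset.univ.biUnion t : Finset C) : Set C)) (Finset.finite_toSet _) (by
        intro a ha
        obtain ⟨i, -, hi⟩ := Finset.mem_biUnion.1 ha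
        exact ht i hi)
    obtain ⟨y, hy, hyx⟩ := isPure_iff.1 (h X hX).isPure m n r x fun i =>
      Submodule.span_mono (fun a ha => htX
        (Finset.mem_biUnion.2 ⟨i, Finset.mem_univ i, ha⟩)) (hxt i)
    exact ⟨y, fun j => Submodule.span_mono (Set.subset_sUnion_of_mem hX) (hy j), hyx⟩
  · intro z hz y hy
    obtain ⟨X, hX, hzX⟩ := hc.exists_mem_subset_of_finite_of_subset_sUnion hne
      (Finset.finite_toSet _) hz
    exact Finsupp.supported_mono (Set.subset_sUnion_of_mem hX) ((h X hX).section_mem z hzX y hy)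

/-- X may be large, so everything is done modulo X. For each datum `f` over S, one relation `ζ f` or
one solution `ξ` modulo X is chosen, and only these force new elements into S. Any other relation or
solution with the same `f` differs from it by one that closedness of X handles. -/
theorem IsClosedSet.exists_superset {κ : Cardinal.{w}} (hκ : ℵ₀ ≤ κ)
    (hV : lift.{w} #V ≤ lift.{u} κ) {X : Set C} (hX : IsClosedSet s X) (c : C) :
    ∃ S : Set C, c ∈ S ∧ #S ≤ κ ∧ IsClosedSet s (X ∪ S) := by
  classical
  have hζ : ∀ f : C →₀ V, ∃ z : relationModule V C,
      (∃ z' : relationModule V C, (z' : C →₀ V) - f ∈ Finsupp.supported V V X) →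
        (z : C →₀ V) - f ∈ Finsupp.supported V V X := fun f => by
    by_cases h : ∃ z' : relationModule V C, (z' : C →₀ V) - f ∈ Finsupp.supported V V X
    · exact ⟨h.choose, fun _ => h.choose_spec⟩
    · exact ⟨0, fun h' => absurd h' h⟩
  have hξ : ∀ (m n : ℕ) (r : Fin m → Fin n → V) (f : Fin m → C), ∃ x : Fin n → C,
      (∃ x' : Fin n → C, ∀ i, ∑ j, r i j • x' j - f i ∈ Submodule.span V X) →
        ∀ i, ∑ j, r i j • x j - f i ∈ Submodule.span V X := fun m n r f => by
    by_cases h : ∃ x' : Fin n → C, ∀ i, ∑ j, r i j • x' j - f i ∈ Submodule.span V X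
    · exact ⟨h.choose, fun _ => h.choose_spec⟩
    · exact ⟨0, fun h' => absurd h' h⟩
  choose ζ hζ using hζ
  choose ξ hξ using hξ
  let Z : (C →₀ V) → Finset C := fun f => (s (ζ f)).support.biUnion fun y => (y : C →₀ V).support
  let Φ : Finset C → Set C := fun t =>
    (⋃ (n : ℕ) (r : Fin n → V) (x : Fin n → t), ↑(Z (∑ i, Finsupp.single (x i : C) (r i)))) ∪
    ⋃ (m : ℕ) (n : ℕ) (r : Fin m → Fin n → V) (f : Fin m → Submodule.span V (t : Set C)),
      Set.range (ξ m n r fun i => (f i : C))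
  have hfin : ∀ {β : Type w} [Finite β], #β ≤ κ := fun {β} _ => (mk_le_aleph0).trans hκ
  have hΦ : ∀ t, #(Φ t) ≤ κ := fun t => by
    refine (mk_union_le _ _).trans ((add_le_add ?_ ?_).trans_eq (add_eq_self hκ))
    · exact mk_iUnion_le_of_le hκ _ (lift_mk_nat_le hκ) fun n =>
        mk_iUnion_le_of_le hκ _ (lift_mk_pi_fin_le hκ hV n) fun r =>
        mk_iUnion_le_of_le hκ _ (lift_le.2 hfin) fun x => hfin
    · exact mk_iUnion_le_of_le hκ _ (lift_mk_nat_le hκ) fun m =>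
        mk_iUnion_le_of_le hκ _ (lift_mk_nat_le hκ) fun n =>
        mk_iUnion_le_of_le hκ _ (lift_mk_pi_fin_le hκ (lift_mk_pi_fin_le hκ hV n) m) fun r =>
        mk_iUnion_le_of_le hκ _
          (lift_mk_pi_fin_le hκ (lift_le.2 (mk_span_le_of_le hκ hV _ hfin)) m) fun f => hfin
  obtain ⟨S, hcS, hSκ, hSΦ⟩ := exists_closed_superset hκ Φ hΦ {c} hfin
  refine ⟨S, hcS rfl, hSκ, ?_, fun z hz y hy => ?_⟩
  · rw [isPure_iff]
    intro m n r x hx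
    simp only [Submodule.span_union, Submodule.mem_sup] at hx
    choose g hg f hf hgf using hx
    choose t ht hft using fun i => Submodule.mem_span_finite_of_mem_span (hf i)
    have hfT : ∀ i, f i ∈ Submodule.span V ((Finset.univ.biUnion t : Finset C) : Set C) :=
      fun i => Submodule.span_mono (fun a ha =>
        Finset.mem_coe.2 (Finset.mem_biUnion.2 ⟨i, Finset.mem_univ i, ha⟩)) (hft i)
    have hξS : ∀ j, ξ m n r f j ∈ S := fun j => hSΦ (Finset.univ.biUnion t)
      (fun a ha => by
        obtain ⟨i, -, hi⟩ := Finset.mem_biUnion.1 ha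
        exact ht i hi)
      (Or.inr (by
        simp only [Set.mem_iUnion]
        exact ⟨m, n, r, fun i => ⟨f i, hfT i⟩, j, rfl⟩))
    have h1 := hξ m n r f ⟨x, fun i => by rw [← hgf, add_sub_cancel_right]; exact hg i⟩
    obtain ⟨y, hy, hyx⟩ := isPure_iff.1 hX.isPure m n r (fun j => x j - ξ m n r f j) fun i => by
      have h2 : ∑ j, r i j • (x j - ξ m n r f j) = g i - (∑ j, r i j • ξ m n r f j - f i) := by
        simp only [smul_sub, Finset.sum_sub_distrib, ← hgf]
        abel
      rw [h2]
      exact Submodule.sub_mem _ (hg i) (h1 i)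
    refine ⟨fun j => y j + ξ m n r f j, fun j => Submodule.add_mem _
      (Submodule.span_mono Set.subset_union_left (hy j))
      (Submodule.subset_span (Or.inr (hξS j))), fun i => ?_⟩
    simp only [smul_add, Finset.sum_add_distrib, hyx, smul_sub, Finset.sum_sub_distrib]
    abel
  · rw [Finsupp.supported_union, Submodule.mem_sup] at hz
    obtain ⟨g, hg, f, hf, hgf⟩ := hz
    have h1 : (ζ f : C →₀ V) - f ∈ Finsupp.supported V V X :=
      hζ f ⟨z, by rw [← hgf, add_sub_cancel_right]; exact hg⟩
    have h2 : ((z - ζ f : relationModule V C) : C →₀ V) ∈ Finsupp.supported V V X := by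
      have h3 : ((z - ζ f : relationModule V C) : C →₀ V) = g - ((ζ f : C →₀ V) - f) := by
        rw [Submodule.coe_sub, ← hgf]
        abel
      rw [h3]
      exact Submodule.sub_mem _ hg h1
    have h4 : s z = s (z - ζ f) + s (ζ f) := eq_add_of_sub_eq (s.map_sub z (ζ f)).symm
    rw [h4] at hy
    rcases Finset.mem_union.1 (Finsupp.support_add hy) with hy | hy
    · exact Finsupp.supported_mono Set.subset_union_left (hX.section_mem _ h2 y hy)
    · refine Finsupp.supported_mono Set.subset_union_right ?_
      obtain ⟨n, r, x, rfl⟩ := exists_fin_sum_of_mem_supported hf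
      intro a ha
      refine hSΦ (Finset.univ.image fun i => (x i : C)) (fun b hb => ?_) (Or.inl ?_)
      · obtain ⟨i, -, rfl⟩ := Finset.mem_image.1 hb
        exact (x i).2
      · simp only [Set.mem_iUnion]
        exact ⟨n, r, fun i => ⟨x i, Finset.mem_image_of_mem _ (Finset.mem_univ i)⟩,
          Finset.mem_biUnion.2 ⟨y, hy, ha⟩⟩

end ClosedSets

section Tight

variable {V : Type u} [CommRing V] {C : Type (max u v)} [AddCommGroup C] [Module V C]
  {s : relationModule V C →ₗ[V] (relationModule V C →₀ V)}

/-- C/⟨X⟩ is the free module on the complement of X modulo the restrictions of the relations to that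
complement. These restrictions form a projective module, because closedness lets `s` descend to a
section of a free cover of it. -/
theorem IsClosedSet.isTight {X : Set C} (hX : IsClosedSet s X)
    (hs : ∀ z, Finsupp.linearCombination V (id : relationModule V C → _) (s z) = z) :
    IsTight (Submodule.span V X) := by
  classical
  let D := Submodule.span V X
  let F := ((Xᶜ : Set C) →₀ V)
  let g : F →ₗ[V] C ⧸ D := Finsupp.linearCombination V fun c => D.mkQ c
  let ρ : (C →₀ V) →ₗ[V] F := Finsupp.lsubtypeDomain Xᶜ
  have hρ : ∀ f, ρ f = 0 ↔ f ∈ Finsupp.supported V V X := fun f => by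
    rw [Finsupp.mem_supported]
    constructor
    · intro h a ha
      by_contra hX
      exact (Finsupp.mem_support_iff.1 ha) (DFunLike.congr_fun h ⟨a, hX⟩)
    · intro h
      ext a
      by_contra ha
      exact a.2 (h (Finsupp.mem_support_iff.2 ha))
  have hρs : Function.Surjective ρ := fun f =>
    ⟨Finsupp.embDomain (Function.Embedding.subtype _) f, by
      ext a; exact Finsupp.embDomain_apply_self (Function.Embedding.subtype _) f a⟩
  have hgρ : ∀ f, g (ρ f) = D.mkQ (Finsupp.linearCombination V id f) := fun f => by
    have : g ∘ₗ ρ = D.mkQ ∘ₗ Finsupp.linearCombination V id := by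
      refine Finsupp.lhom_ext' fun a => LinearMap.ext_ring ?_
      by_cases ha : a ∈ X
      · have h1 : ρ (Finsupp.single a 1) = 0 := (hρ _).2 (Finsupp.single_mem_supported V 1 ha)
        have h2 : D.mkQ a = 0 :=
          (Submodule.Quotient.mk_eq_zero D).2 (Submodule.subset_span ha)
        simpa [h1] using h2.symm
      · have h1 : ρ (Finsupp.single a 1) = Finsupp.single ⟨a, ha⟩ 1 := by
          ext b
          change Finsupp.single a (1 : V) b.1 = _
          simp [Finsupp.single_apply, Subtype.ext_iff]
        have h2 : g (Finsupp.single ⟨a, ha⟩ 1) = D.mkQ a :=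
          (Finsupp.linearCombination_single V 1 _).trans (one_smul V _)
        simp [h1, h2]
    exact congrArg (fun l => l f) this
  have hg : Function.Surjective g := fun b => by
    obtain ⟨c, rfl⟩ := D.mkQ_surjective b
    exact ⟨ρ (Finsupp.single c 1), by simp [hgρ]⟩
  let q : relationModule V C →ₗ[V] F := ρ ∘ₗ (relationModule V C).subtype
  have hexact : Function.Exact (LinearMap.range q).subtype g := fun f => by
    constructor
    · intro hf
      obtain ⟨f, rfl⟩ := hρs f
      rw [hgρ] at hf
      obtain ⟨e, he, hef⟩ := (Finsupp.mem_span_image_iff_linearCombination V).1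
        (show Finsupp.linearCombination V id f ∈ Submodule.span V (id '' X) by
          rw [Set.image_id]; exact (Submodule.Quotient.mk_eq_zero D).1 hf)
      refine ⟨⟨_, ⟨⟨f - e, by simp [hef]⟩, rfl⟩⟩, ?_⟩
      simp [q, (hρ e).2 he]
    · rintro ⟨⟨_, ⟨z, rfl⟩⟩, rfl⟩
      have : g (ρ z) = 0 := by rw [hgρ, LinearMap.mem_ker.1 z.2, map_zero]
      exact this
  -- Relations supported in X restrict to zero, so deleting their basis elements (`i₀`) does not
  -- change `r`. By closedness the deletion makes `i₀ ∘ₗ s` vanish on `ker q`.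
  let L : Set (relationModule V C) := {y | (y : C →₀ V) ∉ Finsupp.supported V V X}
  let r : (relationModule V C →₀ V) →ₗ[V] LinearMap.range q :=
    q.rangeRestrict ∘ₗ Finsupp.linearCombination V id
  let i₀ : (relationModule V C →₀ V) →ₗ[V] (relationModule V C →₀ V) :=
    (Finsupp.supported V V L).subtype ∘ₗ Finsupp.restrictDom V V L
  have hi₀ : ∀ f, i₀ f = f.filter (· ∈ L) := fun f => rfl
  have hr : ∀ f, r (i₀ f) = r f := fun f => by
    have : r ∘ₗ i₀ = r := by
      refine Finsupp.lhom_ext' fun y => LinearMap.ext_ring ?_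
      by_cases hy : y ∈ L
      · simp [hi₀, Finsupp.filter_single_of_pos _ hy]
      · have h1 : r (Finsupp.single y 1) = 0 := Subtype.ext (by
          have h2 : ρ y = 0 := (hρ _).2 (not_not.1 hy)
          simpa [r, q] using h2)
        simp [hi₀, Finsupp.filter_single_of_neg _ hy, h1]
    exact congrArg (fun l => l f) this
  obtain ⟨i, hi⟩ := exists_comp_eq_of_ker_le (P := relationModule V C)
    (B := LinearMap.range q) q.rangeRestrict q.surjective_rangeRestrict (i₀ ∘ₗ s) (by
      intro z hz
      have hz' : (z : C →₀ V) ∈ Finsupp.supported V V X := 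
        (hρ z).1 (congrArg Subtype.val (LinearMap.mem_ker.1 hz))
      rw [LinearMap.mem_ker, LinearMap.comp_apply, hi₀, Finsupp.filter_eq_zero_iff]
      intro y hy
      by_contra h
      exact hy (hX.section_mem z hz' y (Finsupp.mem_support_iff.2 h)))
  have hi' : ∀ z, i (q.rangeRestrict z) = i₀ (s z) := fun z => congrArg (fun l => l z) hi
  have : Module.Projective V (LinearMap.range q) := by
    refine Module.Projective.of_split i r (LinearMap.ext fun x => ?_)
    obtain ⟨z, rfl⟩ := q.surjective_rangeRestrict x
    rw [LinearMap.comp_apply, hi', hr]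
    simp only [r, LinearMap.comp_apply, hs, LinearMap.id_apply]
  exact isObject_of_projective_ker.{u, v} (F := F) (K := LinearMap.range q) g
    (LinearMap.range q).subtype (Submodule.subtype_injective _) hexact hg

end Tight

/-! ### Extension from arbitrary pure tight submodules. -/

section Extension

variable {V : Type u} [CommRing V]

theorem IsPure.submoduleOf {B : Type w} [AddCommGroup B] [Module V B] {A D : Submodule V B}
    (hA : IsPure A) (hAD : A ≤ D) : IsPure (A.submoduleOf D) := by
  rw [isPure_iff] at *
  intro m n r x hx
  obtain ⟨y, hy, hyx⟩ := hA m n r (fun j => x j) fun i => by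
    simpa [Submodule.submoduleOf] using hx i
  exact ⟨fun j => ⟨y j, hAD (hy j)⟩, hy, fun i => Subtype.ext (by simpa using hyx i)⟩

/-- D/A is the kernel of a surjection B/A → B/D between objects. -/
theorem IsTight.submoduleOf {B : Type w} [AddCommGroup B] [Module V B] {A D : Submodule V B}
    (hA : IsTight A) (hD : IsTight D) (hAD : A ≤ D) : IsTight (A.submoduleOf D) := by
  have h : A.submoduleOf D ≤ A.comap D.subtype := le_rfl
  refine IsObject.left_of_exact ((A.submoduleOf D).mapQ A D.subtype h)
    (A.mapQ D LinearMap.id hAD) ?_ ?_ ?_ hA hD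
  · rw [injective_iff_map_eq_zero]
    intro x hx
    obtain ⟨x, rfl⟩ := Submodule.mkQ_surjective _ x
    exact (Submodule.Quotient.mk_eq_zero _).2 ((Submodule.Quotient.mk_eq_zero A).1 hx)
  · intro x
    obtain ⟨x, rfl⟩ := Submodule.mkQ_surjective _ x
    constructor
    · intro hx
      exact ⟨(A.submoduleOf D).mkQ ⟨x, (Submodule.Quotient.mk_eq_zero D).1 hx⟩, rfl⟩
    · rintro ⟨y, hy⟩
      obtain ⟨y, rfl⟩ := Submodule.mkQ_surjective _ y
      rw [← hy]
      exact (Submodule.Quotient.mk_eq_zero D).2 y.2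
  · intro x
    obtain ⟨x, rfl⟩ := Submodule.mkQ_surjective _ x
    exact ⟨A.mkQ x, rfl⟩

theorem IsTight.comap_mkQ {B : Type w} [AddCommGroup B] [Module V B] {A : Submodule V B}
    {D : Submodule V (B ⧸ A)} (hD : IsTight D) : IsTight (D.comap A.mkQ) := by
  refine IsObject.congr ((Submodule.quotEquivOfEq _ _ ?_).trans
    ((D.mkQ ∘ₗ A.mkQ).quotKerEquivOfSurjective
      (D.mkQ_surjective.comp A.mkQ_surjective))).symm hD
  rw [LinearMap.ker_comp, Submodule.ker_mkQ]

theorem mk_quotient_submoduleOf_comap_mkQ_le {B : Type w} [AddCommGroup B] [Module V B]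
    {A : Submodule V B} (X S : Set (B ⧸ A)) :
    #(((Submodule.span V (X ∪ S)).comap A.mkQ) ⧸
      ((Submodule.span V X).comap A.mkQ).submoduleOf ((Submodule.span V (X ∪ S)).comap A.mkQ)) ≤
      #(Submodule.span V S) := by
  choose o ho using A.mkQ_surjective
  refine mk_le_of_surjective (f := fun t => Submodule.Quotient.mk ⟨o t, by
    rw [Submodule.mem_comap, ho]
    exact Submodule.span_mono Set.subset_union_right t.2⟩) fun b => ?_
  obtain ⟨⟨b, hb⟩, rfl⟩ := Submodule.mkQ_surjective _ b
  have hb' := hb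
  rw [Submodule.mem_comap, Submodule.span_union, Submodule.mem_sup] at hb'
  obtain ⟨x, hx, t, ht, h⟩ := hb'
  refine ⟨⟨t, ht⟩, (Submodule.Quotient.eq _).2 ?_⟩
  change A.mkQ (o t - b) ∈ Submodule.span V X
  rw [map_sub, ho, ← h]
  simpa using hx

/-- Homomorphisms extend from all pure tight submodules if they do so for modules of bounded
cardinality. -/
theorem ExtendsFromSmall.exists_extension_of_isTight {κ : Cardinal.{max u v}} (hκ : ℵ₀ ≤ κ)
    (hV : lift.{max u v} #V ≤ lift.{u} κ) {N : Type (max u v)} [AddCommGroup N] [Module V N]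
    (hN : ExtendsFromSmall V κ N) {B : Type (max u v)} [AddCommGroup B] [Module V B]
    (A : Submodule V B) (hA : IsPure A) (hA' : IsTight A) (h : A →ₗ[V] N) :
    ∃ g : B →ₗ[V] N, ∀ a : A, g a = h a := by
  have hproj : Module.Projective V (relationModule V (B ⧸ A)) :=
    projective_ker_of_isObject.{u, v} _ (Finsupp.linearCombination_id_surjective V _) hA'
  obtain ⟨s, hs⟩ := hproj.out
  let D : Set (B ⧸ A) → Submodule V B := fun X => (Submodule.span V X).comap A.mkQ
  have hDmono : Monotone D := fun X Y hXY => Submodule.comap_mono (Submodule.span_mono hXY)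
  -- Zorn's lemma runs over pairs, so that every domain is the preimage of the span of a closed set
  -- and hence pure and tight in B.
  let T : Set (Set (B ⧸ A) × (B →ₗ.[V] N)) :=
    {q | IsClosedSet s q.1 ∧ q.2.domain = D q.1 ∧ ⟨A, h⟩ ≤ q.2}
  have hT₀ : (∅, ⟨A, h⟩) ∈ T := by
    refine ⟨isClosedSet_empty s, ?_, le_rfl⟩
    simp only [D, Submodule.span_empty]
    exact (Submodule.ker_mkQ A).symm
  obtain ⟨⟨X, g⟩, -, hmax⟩ := zorn_le_nonempty₀ T (fun c hcT hc y hy => by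
    have hc₁ : DirectedOn (· ⊆ ·) (Prod.fst '' c) := by
      rintro _ ⟨p, hp, rfl⟩ _ ⟨q, hq, rfl⟩
      rcases hc.total hp hq with h | h
      exacts [⟨_, ⟨q, hq, rfl⟩, h.1, subset_rfl⟩, ⟨_, ⟨p, hp, rfl⟩, subset_rfl, h.1⟩]
    have hc₂ : DirectedOn (· ≤ ·) (Prod.snd '' c) := by
      rintro _ ⟨p, hp, rfl⟩ _ ⟨q, hq, rfl⟩
      rcases hc.total hp hq with h | h
      exacts [⟨_, ⟨q, hq, rfl⟩, h.2, le_rfl⟩, ⟨_, ⟨p, hp, rfl⟩, le_rfl, h.2⟩]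
    have hne : c.Nonempty := ⟨y, hy⟩
    refine ⟨(⋃₀ (Prod.fst '' c), LinearPMap.sSup _ hc₂), ⟨?_, ?_, ?_⟩, fun z hz =>
      ⟨Set.subset_sUnion_of_mem ⟨z, hz, rfl⟩, LinearPMap.le_sSup hc₂ ⟨z, hz, rfl⟩⟩⟩
    · refine isClosedSet_sUnion s hc₁ (hne.image _) ?_
      rintro _ ⟨q, hq, rfl⟩
      exact (hcT hq).1
    · ext b
      rw [LinearPMap.mem_domain_sSup_iff (hne.image _)]
      constructor
      · rintro ⟨_, ⟨q, hq, rfl⟩, hb⟩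
        rw [(hcT hq).2.1] at hb
        exact hDmono (Set.subset_sUnion_of_mem (Set.mem_image_of_mem _ hq)) hb
      · intro hb
        obtain ⟨t, ht, hbt⟩ := Submodule.mem_span_finite_of_mem_span (Submodule.mem_comap.1 hb)
        obtain ⟨_, ⟨q, hq, rfl⟩, htq⟩ := hc₁.exists_mem_subset_of_finite_of_subset_sUnion
          (hne.image _) t.finite_toSet ht
        refine ⟨q.2, Set.mem_image_of_mem _ hq, ?_⟩
        rw [(hcT hq).2.1]
        exact Submodule.span_mono htq hbt
    · exact (hcT hy).2.2.trans (LinearPMap.le_sSup hc₂ (Set.mem_image_of_mem _ hy))) _ hT₀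
  obtain ⟨hX, hgX, hg⟩ := hmax.prop
  have hspan : ∀ c, c ∈ Submodule.span V X := fun c => by
    -- The step from D X to D (X ∪ S) has quotient of cardinality at most κ, so the small-quotient
    -- case extends `g`; maximality then forces `c` into X.
    obtain ⟨S, hcS, hSκ, hXS⟩ := hX.exists_superset s hκ hV c
    have hle : D X ≤ D (X ∪ S) := hDmono Set.subset_union_left
    obtain ⟨g', hg'⟩ := hN.exists_extension hκ hV ((D X).submoduleOf (D (X ∪ S)))
      ((hA.comap_mkQ hX.isPure).submoduleOf hle)
      ((IsClosedSet.isTight.{u, v} hX (fun z => hs z)).comap_mkQ.submoduleOf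
        (IsClosedSet.isTight.{u, v} hXS (fun z => hs z)).comap_mkQ hle)
      ((mk_quotient_submoduleOf_comap_mkQ_le X S).trans (mk_span_le_of_le hκ hV S hSκ))
      (g.toFun ∘ₗ LinearMap.codRestrict g.domain
        ((D (X ∪ S)).subtype ∘ₗ ((D X).submoduleOf (D (X ∪ S))).subtype) fun z => by
          rw [hgX]; exact z.2)
    have hgg' : g ≤ ⟨D (X ∪ S), g'⟩ := by
      refine ⟨hgX.trans_le hle, fun x y hxy => ?_⟩
      have hx : (y : B) ∈ D X := by rw [← hxy, ← hgX]; exact x.2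
      refine Eq.trans ?_ (hg' ⟨y, hx⟩).symm
      exact congrArg g.toFun (Subtype.ext hxy)
    have hmem : (X ∪ S, ⟨D (X ∪ S), g'⟩) ∈ T := ⟨hXS, rfl, hg.trans hgg'⟩
    exact Submodule.subset_span ((hmax.le_of_ge hmem ⟨Set.subset_union_left, hgg'⟩).1 (Or.inr hcS))
  have htop : ∀ b, b ∈ g.domain := fun b => by rw [hgX]; exact hspan _
  exact ⟨g.toFun ∘ₗ LinearMap.codRestrict g.domain LinearMap.id htop,
    fun a => (hg.2 (x := a) (y := ⟨a, htop a⟩) rfl).symm⟩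

end Extension

/-! ### Pure-injectivity from extension of homomorphisms. -/

section PureInjective

variable {V : Type u} [CommRing V]

theorem LinearSystem.exists_finset_mem_span {I J M : Type w} (S : LinearSystem V I J M)
    {n : ℕ} (h : Fin n → J →₀ V) (hh : ∀ i, h i ∈ S.lhsSpan) :
    ∃ t : Finset I, ∀ i, h i ∈ Submodule.span V (S.lhs '' t) := by
  classical
  have : ∀ i, ∃ t : Finset I, h i ∈ Submodule.span V (S.lhs '' t) := fun i => by
    obtain ⟨t, ht, hit⟩ := Submodule.mem_span_finite_of_mem_span (hh i)
    rw [← Set.image_univ] at ht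
    obtain ⟨t', -, rfl⟩ := Finset.subset_set_image_iff.1 ht
    exact ⟨t', by simpa using hit⟩
  choose t ht using this
  exact ⟨Finset.univ.biUnion t, fun i => Submodule.span_mono (Set.image_mono fun a ha =>
    Finset.mem_coe.2 (Finset.mem_biUnion.2 ⟨i, Finset.mem_univ i, ha⟩)) (ht i)⟩

/-- The extension attached to an adequate system is pure. -/
theorem LinearSystem.FinitelySolvable.isPure {I J M X : Type w} [AddCommGroup M] [Module V M]
    [AddCommGroup X] [Module V X] {S : LinearSystem V I J M} (hS : S.FinitelySolvable)
    (φ : S.lhsSpan →ₗ[V] M)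
    (hφ : ∀ i, φ ⟨S.lhs i, Submodule.subset_span (Set.mem_range_self i)⟩ = S.rhs i)
    (k : M →ₗ[V] X) (u : (J →₀ V) →ₗ[V] X) (g : X →ₗ[V] (J →₀ V) ⧸ S.lhsSpan)
    (hk : Function.Exact k g) (huk : ∀ h : S.lhsSpan, u h = k (φ h))
    (hgu : ∀ x, g (u x) = S.lhsSpan.mkQ x) : IsPure (LinearMap.range k) := by
  rw [isPure_iff]
  intro m n r x hx
  have hx' : ∀ j, ∃ f a, x j = u f + k a := fun j => by
    obtain ⟨f, hf⟩ := S.lhsSpan.mkQ_surjective (g (x j))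
    obtain ⟨a, ha⟩ := (hk (x j - u f)).1 (by rw [map_sub, hgu, hf, sub_self])
    exact ⟨f, a, by rw [ha, add_sub_cancel]⟩
  choose f a hfa using hx'
  have hf : ∀ i, ∑ j, r i j • f j ∈ S.lhsSpan := fun i => by
    have h1 := (hk _).2 (hx i)
    rw [← Submodule.Quotient.mk_eq_zero, ← Submodule.mkQ_apply, ← h1, map_sum, map_sum]
    simp [hfa, hgu, hk.apply_apply_eq_zero]
  obtain ⟨t, ht⟩ := S.exists_finset_mem_span _ hf
  -- Only finitely many left sides enter the given system. A solution `y` of that subsystem defines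
  -- `ψ`, which agrees with `φ` on their span and so moves the free components of `x` into M.
  obtain ⟨y, hy⟩ := hS t
  let ψ : (J →₀ V) →ₗ[V] M := Finsupp.linearCombination V y
  have hψ : ∀ z (hz : z ∈ S.lhsSpan), z ∈ Submodule.span V (S.lhs '' t) → φ ⟨z, hz⟩ = ψ z := by
    intro z hz hzt
    have hle : Submodule.span V (S.lhs '' t) ≤ S.lhsSpan :=
      Submodule.span_mono (Set.image_subset_range _ _)
    have : Submodule.span V (S.lhs '' t) ≤
        (LinearMap.ker (φ - ψ ∘ₗ S.lhsSpan.subtype)).map S.lhsSpan.subtype := by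
      rw [Submodule.span_le]
      rintro _ ⟨i, hi, rfl⟩
      refine ⟨⟨S.lhs i, Submodule.subset_span (Set.mem_range_self i)⟩, ?_, rfl⟩
      have h1 : ψ (S.lhs i) = S.rhs i := hy i hi
      simp [hφ, h1]
    obtain ⟨z', hz', rfl⟩ := this hzt
    exact sub_eq_zero.1 hz'
  refine ⟨fun j => k (ψ (f j) + a j), fun j => ⟨_, rfl⟩, fun i => ?_⟩
  have h1 : k (ψ (∑ j, r i j • f j)) = u (∑ j, r i j • f j) := by
    rw [← hψ _ (hf i) (ht i), ← huk]
  simp only [map_sum, map_smul] at h1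
  simp only [hfa, map_add, smul_add, Finset.sum_add_distrib, h1]

/-- For (α), extend the inverse of N → im N. For (γ), push out the presentation F → F/H along H → N:
finite solvability makes the extension pure, and a retraction evaluated at the unknowns solves the
system. -/
theorem isPureInjective_of_exists_extension {N : Type (max u v)} [AddCommGroup N] [Module V N]
    (hN : IsObject V N)
    (H : ∀ (B : Type (max u v)) [AddCommGroup B] [Module V B] (A : Submodule V B), IsPure A →
      IsTight A → ∀ h : A →ₗ[V] N, ∃ g : B →ₗ[V] N, ∀ a : A, g a = h a) :
    IsPureInjective V N := by
  have hP : PextVanishes V N := by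
    intro C X _ _ _ _ f g hC hf hfg hg hp
    obtain ⟨r, hr⟩ := H X (LinearMap.range f) hp
      (IsObject.congr ((Submodule.quotEquivOfEq _ _ hfg.linearMap_ker_eq.symm).trans
        (g.quotKerEquivOfSurjective hg)).symm hC) (LinearEquiv.ofInjective f hf).symm.toLinearMap
    refine ⟨r, LinearMap.ext fun x => ?_⟩
    exact (hr ⟨f x, ⟨x, rfl⟩⟩).trans ((LinearEquiv.ofInjective f hf).symm_apply_apply x)
  refine ⟨hN, hP, fun B _ _ A _ hA hp f _ => H B A hp hA f, ?_⟩
  rintro I J S ⟨⟨φ, hφ⟩, hS, hfin⟩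
  obtain ⟨X, _, _, k, u, g, hk, hkg, hg, huk, hgu⟩ :=
    exists_pushout_extension.{max u v} S.lhsSpan φ
  obtain ⟨ρ, hρ⟩ := hP _ X k g hS hk hkg hg (hfin.isPure φ hφ k u g hkg huk hgu)
  refine ⟨fun j => ρ (u (Finsupp.single j 1)), fun i => ?_⟩
  have h1 : Finsupp.linearCombination V (fun j => ρ (u (Finsupp.single j 1))) = ρ ∘ₗ u :=
    Finsupp.lhom_ext' fun j => LinearMap.ext_ring (by simp)
  have h2 : u (S.lhs i) = k (S.rhs i) := by
    rw [← hφ i, ← huk]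
  calc (S.lhs i).sum (fun j r => r • ρ (u (Finsupp.single j 1))) = ρ (u (S.lhs i)) :=
        congrArg (fun l => l (S.lhs i)) h1
    _ = S.rhs i := by rw [h2]; exact congrArg (fun l => l (S.rhs i)) hρ

end PureInjective

end TightModules

theorem mainTheorem4 (V : Type u) [CommRing V] [IsDomain V] [ValuationRing V]
    (M : Type (max u v)) [AddCommGroup M] [Module V M] (hM : TightModules.IsObject V M) :
    ∃ (N : Type (max u v)) (_ : AddCommGroup N) (_ : Module V N) (f : M →ₗ[V] N),
      TightModules.IsPureInjective V N ∧ Function.Injective f ∧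
        TightModules.IsTight (LinearMap.range f) ∧ TightModules.IsPure (LinearMap.range f) := by
  -- An infinite bound on |V| keeps spans and the closing-off constructions within κ.
  let κ : Cardinal.{max u v} := max Cardinal.aleph0 (Cardinal.lift.{v} (Cardinal.mk V))
  have hκ : Cardinal.aleph0 ≤ κ := le_max_left _ _
  have hV : Cardinal.lift.{max u v} (Cardinal.mk V) ≤ Cardinal.lift.{u} κ := by
    rw [Cardinal.lift_umax.{u, v}]
    exact (le_max_right _ _).trans (Cardinal.lift_id'.{u, max u v} κ).ge
  obtain ⟨N, _, _, f, hf, hp, ht, hN⟩ := TightModules.exists_pureTight_embedding.{u, v} (V := V) κ M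
  refine ⟨N, inferInstance, inferInstance, f,
    TightModules.isPureInjective_of_exists_extension.{u, v} ?_ ?_, hf, ht, hp⟩
  · exact TightModules.IsObject.of_exact f (LinearMap.range f).mkQ hf
      (LinearMap.exact_map_mkQ_range f) (Submodule.mkQ_surjective _) hM ht
  · intro B _ _ A hA hA' h
    exact hN.exists_extension_of_isTight.{u, v} hκ hV A hA hA' h
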